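/- Let $(M,g)$ be a smooth $(d+1)$-dimensional stationary spacetime: $g$ is a smooth Lorentzian metric of signature $(-,+,\dots,+)$, and $K$ is a smooth, everywhere timelike Killing field with complete orbits, i.e. generating a one-parameter group $(\theta_t)_{t\in\mathbb R}$ of isometries; time is oriented so that $K$ is future directed. Let $\Sigma$ be a smooth (Hausdorff, second countable) $d$-manifold, smoothly embedded in $M$ as a spacelike hypersurface $\Sigma_0$ that meets each orbit of $K$ exactly once, so that $(t,p)\mapsto\theta_t(p)$ is a bijection $\mathbb R\times\Sigma_0\to M$ and the translates $\Sigma_t=\theta_t(\Sigma_0)$ foliate $M$. Let $\gamma_{ab}$ be the induced Riemannian metric on $\Sigma$, $D_a$ its Levi-Civita connection, $d\gamma$ its volume measure, $n^a$ the future-directed unit normal, and let the lapse $\alpha>0$ and the shift $\beta^a$ (tangent to $\Sigma$) be defined by $K^a=\alpha n^a+\beta^a$. Let $m\in\mathbb R$ and $\epsilon>0$, and assume $$m^2>0\qquad\text{and}\qquad \alpha-\frac{\beta_a\beta^a}{\alpha}\ \ge\ \epsilon\quad\text{on }\Sigma .$$ On pairs $\Phi=(\varphi,\pi)\in C_0^\infty(\Sigma)\oplus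 C_0^\infty(\Sigma)$ of real functions put $$\|\Phi\|_{\mathcal A}^2=\int_\Sigma \alpha\Big(\Big[1-\frac{\beta_a\beta^a}{\alpha^2}\Big]\pi^2+\gamma^{ab}\Big[D_a\varphi+\frac{\beta_a}{\alpha}\pi\Big]\Big[D_b\varphi+\frac{\beta_b}{\alpha}\pi\Big]+m^2\varphi^2\Big)\,d\gamma ,$$ let $\mathcal H_{\mathcal A}$ be the real Hilbert space obtained by completing $C_0^\infty(\Sigma)\oplus C_0^\infty(\Sigma)$ in this norm, and let $$h(\varphi,\pi)=\big(-\beta^aD_a\varphi-\alpha\pi,\ -(D^a\alpha)D_a\varphi+\alpha(m^2-D^aD_a)\varphi-(D_a\beta^a)\pi-\beta^aD_a\pi\big),$$ an operator in $\mathcal H_{\mathcal A}$ with domain $C_0^\infty(\Sigma)\oplus C_0^\infty(\Sigma)$. Let $$\sigma\big((\varphi,\pi),(\varphi',\pi')\big)=\int_\Sigma(\varphi\,\pi'-\pi\,\varphi')\,d\gamma .$$ Then $\sigma$ extends to a continuous bilinear form (again denoted $\sigma$) on $\mathcal H_{\mathcal A}$; there is a bounded operator $T$ on $\mathcal H_{\mathcal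 A}$ with $T^*=-T$ and $\sigma(\Phi,\Psi)=\langle\Phi,T\Psi\rangle_{\mathcal A}$ for all $\Phi,\Psi\in\mathcal H_{\mathcal A}$; $T$ is injective, and $h^{SA}:=T^{-1}$, with domain $\operatorname{Ran}T$, is a densely defined skew-adjoint operator (that is, $(h^{SA})^*=-h^{SA}$) that extends $h$. Thus $h$ has a skew-adjoint extension with bounded inverse $T$. Moreover this extension conserves $\sigma$: the strongly continuous one-parameter group of isometries $e^{-h^{SA}t}$ with generator $-h^{SA}$ exists and satisfies $$\sigma(e^{-h^{SA}t}\Phi,e^{-h^{SA}t}\Psi)=\sigma(\Phi,\Psi)\qquad\text{for all }t\in\mathbb R,\ \Phi,\Psi\in\mathcal H_{\mathcal A}.$$ -/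

import Mathlib

open Bundle Manifold MeasureTheory Set Topology
open scoped ContDiff InnerProductSpace

noncomputable section
namespace StationaryKG

section Riemannian
variable {d : ℕ} {X : Type*} [TopologicalSpace X] [ChartedSpace (EuclideanSpace ℝ (Fin d)) X]
  [IsManifold (𝓡 d) ∞ X]

/-- Smooth Riemannian metrics on the `d`-dimensional manifold `X`. -/
abbrev RMetric (d : ℕ) (X : Type*) [TopologicalSpace X]
    [ChartedSpace (EuclideanSpace ℝ (Fin d)) X] [IsManifold (𝓡 d) ∞ X] :=
  ContMDiffRiemannianMetric (𝓡 d) ∞ (EuclideanSpace ℝ (Fin d))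
    (fun p : X => TangentSpace (𝓡 d) p)

/-- Raising an index: `sharp γ p η` is the vector `v` with `γ(v, ·) = η`. -/
def sharp (γ : RMetric d X) (p : X) (η : TangentSpace (𝓡 d) p →L[ℝ] ℝ) : TangentSpace (𝓡 d) p :=
  (γ.inner p).inverse η

theorem metric_isInvertible (γ : RMetric d X) (p : X) : (γ.inner p).IsInvertible := by
  have : FiniteDimensional ℝ (TangentSpace (𝓡 d) p) :=
    inferInstanceAs (FiniteDimensional ℝ (EuclideanSpace ℝ (Fin d)))
  have : T2Space (TangentSpace (𝓡 d) p) :=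
    inferInstanceAs (T2Space (EuclideanSpace ℝ (Fin d)))
  let f : TangentSpace (𝓡 d) p →ₗ[ℝ] Module.Dual ℝ (TangentSpace (𝓡 d) p) :=
    { toFun := fun v => (γ.inner p v : TangentSpace (𝓡 d) p →ₗ[ℝ] ℝ)
      map_add' := fun v w => by ext; simp
      map_smul' := fun c w => by ext; simp }
  have hf : Function.Injective f := by
    rw [injective_iff_map_eq_zero]
    intro v hv
    by_contra h
    have h1 := γ.pos p v h
    have h2 : f v v = 0 := by rw [hv]; rfl
    exact h1.ne' h2
  have hs : Function.Surjective f :=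
    (LinearMap.injective_iff_surjective_of_finrank_eq_finrank
      (Subspace.dual_finrank_eq (K := ℝ) (V := TangentSpace (𝓡 d) p)).symm).1 hf
  have hb : Function.Bijective (γ.inner p) := by
    constructor
    · intro v w h
      apply hf
      ext x
      exact congrArg (fun l => l x) h
    · intro η
      obtain ⟨v, hv⟩ := hs η.toLinearMap
      refine ⟨v, ?_⟩
      ext x
      exact congrArg (fun l => l x) hv
  exact ⟨(LinearEquiv.ofBijective (γ.inner p).toLinearMap hb).toContinuousLinearEquiv, by ext; rfl⟩

theorem inner_sharp (γ : RMetric d X) (p : X) (η : TangentSpace (𝓡 d) p →L[ℝ] ℝ) :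
    γ.inner p (sharp γ p η) = η :=
  (metric_isInvertible γ p).self_apply_inverse η

/-- The gradient `D^a f`. -/
def grad (γ : RMetric d X) (f : X → ℝ) (p : X) : TangentSpace (𝓡 d) p :=
  sharp γ p (mvfderiv (𝓡 d) f p)

/-- The coordinate vector field `∂_i` of the chart at `q`, at the point with coordinates `y`. -/
def coordVec (q : X) (y : EuclideanSpace ℝ (Fin d)) (i : Fin d) :
    TangentSpace (𝓡 d) ((extChartAt (𝓡 d) q).symm y) :=
  mfderiv 𝓘(ℝ, EuclideanSpace ℝ (Fin d)) (𝓡 d) (extChartAt (𝓡 d) q).symm y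
    (EuclideanSpace.single i 1)

/-- The matrix `γ_ij` of the metric in the chart at `q`. -/
def gram (γ : RMetric d X) (q : X) (y : EuclideanSpace ℝ (Fin d)) : Matrix (Fin d) (Fin d) ℝ :=
  Matrix.of fun i j => γ.inner ((extChartAt (𝓡 d) q).symm y) (coordVec q y i) (coordVec q y j)

/-- The volume density `√(det γ_ij)` in the chart at `q`. -/
def volDensity (γ : RMetric d X) (q : X) (y : EuclideanSpace ℝ (Fin d)) : ℝ :=
  Real.sqrt (gram γ q y).det

/-- The measure `√(det γ_ij) dx¹ ⋯ dx^d` on the domain of the chart at `q`. -/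
def chartVolume [MeasurableSpace X] (γ : RMetric d X) (q : X) : Measure X :=
  ((volume.restrict (extChartAt (𝓡 d) q).target).withDensity
    fun y => ENNReal.ofReal (volDensity γ q y)).map (extChartAt (𝓡 d) q).symm

/-- The Riemannian volume measure `dγ`: the chart volumes agree on overlaps of chart domains
(`chartVolume_eq`), and `dγ` is the smallest measure that dominates all of them. -/
def riemVolume [MeasurableSpace X] (γ : RMetric d X) : Measure X := ⨆ q : X, chartVolume γ q

/-- The `i`-th component of the vector field `V` in the chart at `q`. -/
def coordComp (V : ∀ p : X, TangentSpace (𝓡 d) p) (q : X) (y : EuclideanSpace ℝ (Fin d))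
    (i : Fin d) : ℝ :=
  mvfderiv (𝓡 d) (extChartAt (𝓡 d) q) ((extChartAt (𝓡 d) q).symm y)
    (V ((extChartAt (𝓡 d) q).symm y)) i

/-- The divergence `D_a V^a = (det γ)^{-1/2} ∂_i ((det γ)^{1/2} V^i)`. -/
def divergence (γ : RMetric d X) (V : ∀ p : X, TangentSpace (𝓡 d) p) (q : X) : ℝ :=
  (volDensity γ q (extChartAt (𝓡 d) q q))⁻¹ *
    ∑ i : Fin d, fderiv ℝ (fun y => volDensity γ q y * coordComp V q y i)
      (extChartAt (𝓡 d) q q) (EuclideanSpace.single i 1)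

/-- The Laplace–Beltrami operator `D^a D_a f`. -/
def laplacian (γ : RMetric d X) (f : X → ℝ) : X → ℝ := divergence γ (grad γ f)


theorem contMDiff_sharp (γ : RMetric d X) {η : ∀ p : X, TangentSpace (𝓡 d) p →L[ℝ] ℝ}
    (hη : ContMDiff (𝓡 d) ((𝓡 d).prod 𝓘(ℝ, EuclideanSpace ℝ (Fin d) →L[ℝ] ℝ)) ∞
      (fun p => TotalSpace.mk' (EuclideanSpace ℝ (Fin d) →L[ℝ] ℝ) p (η p))) :
    ContMDiff (𝓡 d) (𝓡 d).tangent ∞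
      (fun p => (⟨p, sharp γ p (η p)⟩ : TangentBundle (𝓡 d) X)) := by
  intro x₀
  have hγ := γ.contMDiff x₀
  rw [contMDiffAt_hom_bundle] at hγ
  have h2 := hγ.2
  simp only at h2
  set E := EuclideanSpace ℝ (Fin d) with hE
  let T : X → Type := fun p : X => TangentSpace (𝓡 d) p
  let T' : X → Type := fun p : X => T p →L[ℝ] ℝ
  have h3 : ContMDiffAt (𝓡 d) 𝓘(ℝ, (E →L[ℝ] ℝ) →L[ℝ] E) ∞
      (ContinuousLinearMap.inverse ∘ (fun x : X => ContinuousLinearMap.inCoordinates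
        E T (E →L[ℝ] ℝ) T' x₀ x x₀ x (γ.inner x))) x₀ := by
    apply ContMDiffAt.comp _ _ h2
    apply ContDiffAt.contMDiffAt
    apply ContinuousLinearMap.IsInvertible.contDiffAt_map_inverse
    rw [ContinuousLinearMap.inCoordinates_eq (FiberBundle.mem_baseSet_trivializationAt' x₀)
      (FiberBundle.mem_baseSet_trivializationAt' x₀)]
    exact ContinuousLinearMap.isInvertible_equiv.comp
      ((metric_isInvertible γ x₀).comp ContinuousLinearMap.isInvertible_equiv)
  refine ContMDiffAt.clm_apply_of_inCoordinates (F₁ := E →L[ℝ] ℝ) (E₁ := T') (F₂ := E) (E₂ := T)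
    (b₁ := id) (b₂ := id) (ϕ := fun p => (γ.inner p).inverse) (v := η) ?_ (hη x₀) contMDiffAt_id
  apply h3.congr_of_eventuallyEq
  have A : (trivializationAt E T x₀).baseSet ∈ 𝓝 x₀ :=
    (trivializationAt _ _ _).open_baseSet.mem_nhds (FiberBundle.mem_baseSet_trivializationAt' _)
  have B : (trivializationAt (E →L[ℝ] ℝ) T' x₀).baseSet ∈ 𝓝 x₀ :=
    (trivializationAt _ _ _).open_baseSet.mem_nhds (FiberBundle.mem_baseSet_trivializationAt' _)
  filter_upwards [A, B] with x hx h'x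
  simp only [Function.comp_apply]
  rw [ContinuousLinearMap.inCoordinates_eq hx h'x]
  refine (ContinuousLinearMap.inCoordinates_eq (ϕ := (γ.inner x).inverse) h'x hx).trans ?_
  simp only [ContinuousLinearMap.inverse_equiv_comp, ContinuousLinearMap.inverse_comp_equiv,
    ContinuousLinearEquiv.symm_symm]
  rfl

theorem contMDiff_mvfderiv {f : X → ℝ} (hf : ContMDiff (𝓡 d) 𝓘(ℝ) ∞ f) :
    ContMDiff (𝓡 d) ((𝓡 d).prod 𝓘(ℝ, EuclideanSpace ℝ (Fin d) →L[ℝ] ℝ)) ∞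
      (fun p => TotalSpace.mk' (EuclideanSpace ℝ (Fin d) →L[ℝ] ℝ)
        (E := fun p : X => TangentSpace (𝓡 d) p →L[ℝ] ℝ) p (mvfderiv (𝓡 d) f p)) := by
  intro x₀
  rw [contMDiffAt_hom_bundle]
  refine ⟨contMDiffAt_id, ?_⟩
  have h := (hf x₀).mfderiv_const (m := ∞) (by simp)
  apply h.congr_of_eventuallyEq
  filter_upwards with x
  ext v
  simp [inTangentCoordinates, ContinuousLinearMap.inCoordinates, mvfderiv]
  rfl


/-- The inverse trivialization of the tangent bundle given by the chart at `q`. -/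
theorem coordVec_eq (q : X) {y : EuclideanSpace ℝ (Fin d)} (hy : y ∈ (extChartAt (𝓡 d) q).target)
    (i : Fin d) :
    coordVec q y i = (trivializationAt (EuclideanSpace ℝ (Fin d)) (TangentSpace (𝓡 d)) q).symmL ℝ
      ((extChartAt (𝓡 d) q).symm y) (EuclideanSpace.single i 1) := by
  rw [TangentBundle.symmL_trivializationAt (by simpa using (extChartAt (𝓡 d) q).map_target hy)]
  simp only [modelWithCornersSelf_coe, range_id, mfderivWithin_univ]
  rw [coordVec, (extChartAt (𝓡 d) q).right_inv hy]
  rfl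

/-- The matrix of the metric in the chart at `q`, as a function on the manifold. -/
def gramAt (γ : RMetric d X) (q p : X) : Matrix (Fin d) (Fin d) ℝ :=
  Matrix.of fun i j => γ.inner p
    ((trivializationAt (EuclideanSpace ℝ (Fin d)) (TangentSpace (𝓡 d)) q).symmL ℝ p
      (EuclideanSpace.single i 1))
    ((trivializationAt (EuclideanSpace ℝ (Fin d)) (TangentSpace (𝓡 d)) q).symmL ℝ p
      (EuclideanSpace.single j 1))

theorem gram_eq (γ : RMetric d X) (q : X) {y : EuclideanSpace ℝ (Fin d)}
    (hy : y ∈ (extChartAt (𝓡 d) q).target) :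
    gram γ q y = gramAt γ q ((extChartAt (𝓡 d) q).symm y) := by
  ext i j
  simp only [gram, gramAt, Matrix.of_apply, coordVec_eq q hy]

/-- The vector field on the domain of the chart at `q` with constant components `v`. -/
def frame (q : X) (v : EuclideanSpace ℝ (Fin d)) (p : X) : TangentSpace (𝓡 d) p :=
  (trivializationAt (EuclideanSpace ℝ (Fin d)) (TangentSpace (𝓡 d)) q).symmL ℝ p v

theorem contMDiffOn_frame (q : X) (v : EuclideanSpace ℝ (Fin d)) :
    ContMDiffOn (𝓡 d) (𝓡 d).tangent ∞ (fun p => (⟨p, frame q v p⟩ : TangentBundle (𝓡 d) X))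
      (chartAt (EuclideanSpace ℝ (Fin d)) q).source := by
  intro p hp
  have hp' : p ∈ (trivializationAt (EuclideanSpace ℝ (Fin d)) (TangentSpace (𝓡 d)) q).baseSet := by
    simpa using hp
  have h1 := ((trivializationAt (EuclideanSpace ℝ (Fin d)) (TangentSpace (𝓡 d)) q).contMDiffAt_symmL
    (n := ∞) (IB := 𝓡 d) hp').contMDiffWithinAt
      (s := (chartAt (EuclideanSpace ℝ (Fin d)) q).source)
  refine ContMDiffWithinAt.clm_bundle_apply (F₁ := EuclideanSpace ℝ (Fin d))
    (E₁ := Bundle.Trivial X (EuclideanSpace ℝ (Fin d))) (b := id) (v := fun _ => v) h1 ?_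
  rw [Bundle.contMDiffWithinAt_totalSpace]
  exact ⟨contMDiffWithinAt_id, contMDiffWithinAt_const⟩

theorem contMDiffOn_gramAt (γ : RMetric d X) (q : X) (i j : Fin d) :
    ContMDiffOn (𝓡 d) 𝓘(ℝ) ∞ (fun p => gramAt γ q p i j)
      (chartAt (EuclideanSpace ℝ (Fin d)) q).source := by
  intro p hp
  have := ContMDiffWithinAt.clm_bundle_apply₂ (F₁ := EuclideanSpace ℝ (Fin d))
    (F₂ := EuclideanSpace ℝ (Fin d)) (F₃ := ℝ) (E₃ := Bundle.Trivial X ℝ)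
    (b := id) (γ.contMDiff p).contMDiffWithinAt
    (contMDiffOn_frame q (EuclideanSpace.single i 1) p hp)
    (contMDiffOn_frame q (EuclideanSpace.single j 1) p hp)
  rw [Bundle.contMDiffWithinAt_totalSpace] at this
  exact this.2

/-- A covector field is smooth if its components in charts are. -/
theorem contMDiff_covector {η : ∀ p : X, TangentSpace (𝓡 d) p →L[ℝ] ℝ}
    (h : ∀ q v, ContMDiffOn (𝓡 d) 𝓘(ℝ) ∞ (fun p => η p (frame q v p))
      (chartAt (EuclideanSpace ℝ (Fin d)) q).source) :
    ContMDiff (𝓡 d) ((𝓡 d).prod 𝓘(ℝ, EuclideanSpace ℝ (Fin d) →L[ℝ] ℝ)) ∞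
      (fun p => TotalSpace.mk' (EuclideanSpace ℝ (Fin d) →L[ℝ] ℝ) p (η p)) := by
  intro q
  rw [contMDiffAt_hom_bundle]
  refine ⟨contMDiffAt_id, ?_⟩
  have hU : (chartAt (EuclideanSpace ℝ (Fin d)) q).source ∈ 𝓝 q :=
    (chartAt (EuclideanSpace ℝ (Fin d)) q).open_source.mem_nhds (mem_chart_source _ q)
  let P : Fin d → (EuclideanSpace ℝ (Fin d) →L[ℝ] ℝ) := fun i => EuclideanSpace.proj i
  have h1 : ContMDiffAt (𝓡 d) 𝓘(ℝ, EuclideanSpace ℝ (Fin d) →L[ℝ] ℝ) ∞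
      (fun p => ∑ i, η p (frame q (EuclideanSpace.single i 1) p) • P i) q := by
    refine ContMDiffAt.sum fun i _ => ?_
    exact ((h q (EuclideanSpace.single i 1)).contMDiffAt hU).smul contMDiffAt_const
  refine h1.congr_of_eventuallyEq ?_
  filter_upwards [hU] with p hp
  ext v
  have hv : v = ∑ i, v i • EuclideanSpace.single i (1 : ℝ) := by
    ext j; simp [Pi.single_apply]
  have hfr : frame q v p = ∑ i, v i • frame q (EuclideanSpace.single i 1) p := by
    conv_lhs => rw [hv]
    simp [frame]
  trans η p (frame q v p)
  · simp [ContinuousLinearMap.inCoordinates, frame]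
  · rw [hfr]
    simp [P, mul_comm]

/-- A field of bilinear forms is smooth if its components in charts are. -/
theorem contMDiff_bilin {B : ∀ p : X, TangentSpace (𝓡 d) p →L[ℝ] TangentSpace (𝓡 d) p →L[ℝ] ℝ}
    (h : ∀ q v w, ContMDiffOn (𝓡 d) 𝓘(ℝ) ∞ (fun p => B p (frame q v p) (frame q w p))
      (chartAt (EuclideanSpace ℝ (Fin d)) q).source) :
    ContMDiff (𝓡 d) ((𝓡 d).prod 𝓘(ℝ, EuclideanSpace ℝ (Fin d) →L[ℝ]
        EuclideanSpace ℝ (Fin d) →L[ℝ] ℝ)) ∞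
      (fun p => TotalSpace.mk' (EuclideanSpace ℝ (Fin d) →L[ℝ]
        EuclideanSpace ℝ (Fin d) →L[ℝ] ℝ) p (B p)) := by
  intro q
  rw [contMDiffAt_hom_bundle]
  refine ⟨contMDiffAt_id, ?_⟩
  have hU : (chartAt (EuclideanSpace ℝ (Fin d)) q).source ∈ 𝓝 q :=
    (chartAt (EuclideanSpace ℝ (Fin d)) q).open_source.mem_nhds (mem_chart_source _ q)
  let P : Fin d → (EuclideanSpace ℝ (Fin d) →L[ℝ] ℝ) := fun i => EuclideanSpace.proj i
  have h1 : ContMDiffAt (𝓡 d) 𝓘(ℝ, EuclideanSpace ℝ (Fin d) →L[ℝ]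
      EuclideanSpace ℝ (Fin d) →L[ℝ] ℝ) ∞
      (fun p => ∑ i, ∑ j, B p (frame q (EuclideanSpace.single i 1) p)
        (frame q (EuclideanSpace.single j 1) p) • (P i).smulRight (P j)) q := by
    refine ContMDiffAt.sum fun i _ => ContMDiffAt.sum fun j _ => ?_
    exact ((h q (EuclideanSpace.single i 1) (EuclideanSpace.single j 1)).contMDiffAt hU).smul
      contMDiffAt_const
  refine h1.congr_of_eventuallyEq ?_
  filter_upwards [hU] with p hp
  ext v w
  have hv : ∀ v : EuclideanSpace ℝ (Fin d), v = ∑ i, v i • EuclideanSpace.single i (1 : ℝ) := by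
    intro v; ext j; simp [Pi.single_apply]
  have hfr : ∀ v : EuclideanSpace ℝ (Fin d),
      frame q v p = ∑ i, v i • frame q (EuclideanSpace.single i 1) p := by
    intro v
    conv_lhs => rw [hv v]
    simp [frame]
  trans B p (frame q v p) (frame q w p)
  · have hp' : p ∈ (trivializationAt (EuclideanSpace ℝ (Fin d)) (TangentSpace (𝓡 d)) q).baseSet := by
      simpa using hp
    refine (inCoordinates_apply_eq₂ hp' hp' (mem_univ _)).trans ?_
    simp [frame, Bundle.Trivialization.symmL_apply _ hp']
  · rw [hfr v, hfr w]
    simp only [map_sum, map_smul, sum_apply, smul_apply, P, ContinuousLinearMap.smulRight_apply,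
      EuclideanSpace.coe_proj, smul_eq_mul, Finset.mul_sum]
    rw [Finset.sum_comm]
    refine Finset.sum_congr rfl fun k _ => Finset.sum_congr rfl fun l _ => ?_
    ring

theorem det_gramAt_change (γ : RMetric d X) {q r p : X}
    (hq : p ∈ (chartAt (EuclideanSpace ℝ (Fin d)) q).source)
    (hr : p ∈ (chartAt (EuclideanSpace ℝ (Fin d)) r).source) :
    (gramAt γ q p).det = (tangentCoordChange (𝓡 d) q r p).det ^ 2 * (gramAt γ r p).det := by
  set J := tangentCoordChange (𝓡 d) q r p with hJ
  have key : ∀ v : EuclideanSpace ℝ (Fin d),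
      (trivializationAt (EuclideanSpace ℝ (Fin d)) (TangentSpace (𝓡 d)) q).symmL ℝ p v =
      (trivializationAt (EuclideanSpace ℝ (Fin d)) (TangentSpace (𝓡 d)) r).symmL ℝ p (J v) := by
    intro v
    rw [TangentBundle.symmL_trivializationAt_eq_core hq,
      TangentBundle.symmL_trivializationAt_eq_core hr]
    exact (tangentCoordChange_comp (I := 𝓡 d) (w := q) (x := r) (y := p) (z := p) (v := v)
      (by simp [hq, hr])).symm
  let b := (EuclideanSpace.basisFun (Fin d) ℝ).toBasis
  let A : Matrix (Fin d) (Fin d) ℝ := LinearMap.toMatrix b b J.toLinearMap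
  have hA : A.det = J.det := LinearMap.det_toMatrix b J.toLinearMap
  have hJe : ∀ i : Fin d, J (EuclideanSpace.single i 1) =
      ∑ k, A k i • (EuclideanSpace.single k (1 : ℝ)) := by
    intro i
    have := b.sum_repr (J (b i))
    simp only [b, OrthonormalBasis.coe_toBasis, EuclideanSpace.basisFun_apply] at this
    rw [← this]
    simp [A, LinearMap.toMatrix_apply, b]
  have hg : gramAt γ q p = A.transpose * gramAt γ r p * A := by
    ext i j
    simp only [gramAt, Matrix.of_apply, key, hJe, map_sum, map_smul,
      sum_apply, smul_apply, Matrix.mul_apply,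
      Matrix.transpose_apply, smul_eq_mul, Finset.sum_mul, Finset.mul_sum]
    refine Finset.sum_congr rfl fun k _ => Finset.sum_congr rfl fun l _ => ?_
    ring
  rw [hg, Matrix.det_mul, Matrix.det_mul, Matrix.det_transpose, hA]
  ring


theorem continuousOn_volDensity (γ : RMetric d X) (q : X) :
    ContinuousOn (volDensity γ q) (extChartAt (𝓡 d) q).target := by
  have h : ContinuousOn (fun y => Real.sqrt (gramAt γ q ((extChartAt (𝓡 d) q).symm y)).det)
      (extChartAt (𝓡 d) q).target := by
    have h1 : ContinuousOn (fun p => gramAt γ q p) (extChartAt (𝓡 d) q).source := by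
      refine continuousOn_pi.2 fun i => continuousOn_pi.2 fun j => ?_
      simpa using (contMDiffOn_gramAt γ q i j).continuousOn
    have h2 : ContinuousOn (fun p => Real.sqrt (gramAt γ q p).det) (extChartAt (𝓡 d) q).source :=
      (Continuous.matrix_det continuous_id).comp_continuousOn h1 |>.sqrt
    exact h2.comp (continuousOn_extChartAt_symm q) (extChartAt (𝓡 d) q).symm.mapsTo
  refine h.congr fun y hy => ?_
  rw [volDensity, gram_eq γ q hy]

section measure
variable [MeasurableSpace X] [BorelSpace X]

theorem measurableSet_chart_preimage (q : X) {s : Set X} (hs : MeasurableSet s) :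
    MeasurableSet ((extChartAt (𝓡 d) q).target ∩ (extChartAt (𝓡 d) q).symm ⁻¹' s) := by
  classical
  have hT : MeasurableSet (extChartAt (𝓡 d) q).target := (isOpen_extChartAt_target q).measurableSet
  have hg : Measurable ((extChartAt (𝓡 d) q).target.piecewise (extChartAt (𝓡 d) q).symm
      (fun _ => q)) :=
    (continuousOn_extChartAt_symm q).measurable_piecewise continuousOn_const hT
  convert! hT.inter (hg hs) using 1
  ext y
  simp only [mem_inter_iff, mem_preimage, and_congr_right_iff]
  intro hy
  rw [piecewise_eq_of_mem _ _ _ hy]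

theorem chartVolume_apply (γ : RMetric d X) (q : X) {s : Set X} (hs : MeasurableSet s) :
    chartVolume γ q s =
      ∫⁻ y in (extChartAt (𝓡 d) q).target ∩ (extChartAt (𝓡 d) q).symm ⁻¹' s,
        ENNReal.ofReal (volDensity γ q y) := by
  have hT : MeasurableSet (extChartAt (𝓡 d) q).target := (isOpen_extChartAt_target q).measurableSet
  have hm : AEMeasurable (extChartAt (𝓡 d) q).symm
      (volume.restrict (extChartAt (𝓡 d) q).target) :=
    (continuousOn_extChartAt_symm q).aemeasurable hT
  rw [chartVolume, Measure.map_apply_of_aemeasurable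
    (hm.mono_ac (withDensity_absolutelyContinuous _ _)) hs]
  rw [withDensity_apply' _ _, Measure.restrict_restrict₀', inter_comm]
  exact hT.nullMeasurableSet

/-- The chart volumes agree on the overlap of two chart domains. -/
theorem chartVolume_eq (γ : RMetric d X) (q r : X) {s : Set X} (hs : MeasurableSet s)
    (hq : s ⊆ (chartAt (EuclideanSpace ℝ (Fin d)) q).source)
    (hr : s ⊆ (chartAt (EuclideanSpace ℝ (Fin d)) r).source) :
    chartVolume γ q s = chartVolume γ r s := by
  rw [chartVolume_apply γ q hs, chartVolume_apply γ r hs]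
  set A := (extChartAt (𝓡 d) q).target ∩ (extChartAt (𝓡 d) q).symm ⁻¹' s with hA
  have hAm : MeasurableSet A := measurableSet_chart_preimage q hs
  have hq' : s ⊆ (extChartAt (𝓡 d) q).source := by simpa using hq
  have hr' : s ⊆ (extChartAt (𝓡 d) r).source := by simpa using hr
  let φ := (extChartAt (𝓡 d) r) ∘ (extChartAt (𝓡 d) q).symm
  have himg : φ '' A = (extChartAt (𝓡 d) r).target ∩ (extChartAt (𝓡 d) r).symm ⁻¹' s := by
    ext z
    constructor
    · rintro ⟨y, ⟨hy1, hy2⟩, rfl⟩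
      refine ⟨(extChartAt (𝓡 d) r).map_source (hr' hy2), ?_⟩
      change (extChartAt (𝓡 d) r).symm ((extChartAt (𝓡 d) r) ((extChartAt (𝓡 d) q).symm y)) ∈ s
      rw [(extChartAt (𝓡 d) r).left_inv (hr' hy2)]
      exact hy2
    · rintro ⟨hz1, hz2⟩
      have hz3 := hq' hz2
      refine ⟨extChartAt (𝓡 d) q ((extChartAt (𝓡 d) r).symm z),
        ⟨(extChartAt (𝓡 d) q).map_source hz3, ?_⟩, ?_⟩
      · rw [mem_preimage, (extChartAt (𝓡 d) q).left_inv hz3]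
        exact hz2
      · change (extChartAt (𝓡 d) r) ((extChartAt (𝓡 d) q).symm
          (extChartAt (𝓡 d) q ((extChartAt (𝓡 d) r).symm z))) = z
        rw [(extChartAt (𝓡 d) q).left_inv hz3, (extChartAt (𝓡 d) r).right_inv hz1]
  have hinj : InjOn φ A := by
    intro y hy y' hy' h
    have h1 := (extChartAt (𝓡 d) r).injOn (hr' hy.2) (hr' hy'.2) h
    exact (extChartAt (𝓡 d) q).symm.injOn hy.1 hy'.1 h1
  have hder : ∀ y ∈ A, HasFDerivWithinAt φ
      (tangentCoordChange (𝓡 d) q r ((extChartAt (𝓡 d) q).symm y)) A y := by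
    intro y hy
    have := hasFDerivWithinAt_tangentCoordChange (I := 𝓡 d) (x := q) (y := r)
      (z := (extChartAt (𝓡 d) q).symm y) ⟨hq' hy.2, hr' hy.2⟩
    rw [(extChartAt (𝓡 d) q).right_inv hy.1] at this
    exact this.mono (by simp)
  rw [← himg, lintegral_image_eq_lintegral_abs_det_fderiv_mul volume hAm hder hinj]
  refine setLIntegral_congr_fun hAm fun y hy => ?_
  have hφ : φ y ∈ (extChartAt (𝓡 d) r).target := (extChartAt (𝓡 d) r).map_source (hr' hy.2)
  have hφ' : (extChartAt (𝓡 d) r).symm (φ y) = (extChartAt (𝓡 d) q).symm y :=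
    (extChartAt (𝓡 d) r).left_inv (hr' hy.2)
  rw [← ENNReal.ofReal_mul (abs_nonneg _), volDensity, volDensity, gram_eq γ q hy.1,
    gram_eq γ r hφ, hφ', det_gramAt_change γ (hq hy.2) (hr hy.2),
    Real.sqrt_mul (sq_nonneg _), Real.sqrt_sq_eq_abs]

/-- A countable measurable partition of the manifold into subsets of chart domains. -/
theorem exists_partition [SecondCountableTopology X] :
    ∃ (S : Set X) (_ : S.Countable) (A : S → Set X), (∀ q, MeasurableSet (A q)) ∧
      (∀ q : S, A q ⊆ (chartAt (EuclideanSpace ℝ (Fin d)) (q : X)).source) ∧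
      Pairwise (Function.onFun Disjoint A) ∧ ⋃ q, A q = univ := by
  obtain ⟨S, hS, hcov⟩ := TopologicalSpace.countable_cover_nhds
    (fun q : X => (chartAt (EuclideanSpace ℝ (Fin d)) q).open_source.mem_nhds (mem_chart_source _ q))
  have : Countable S := hS
  obtain ⟨e⟩ : Nonempty (Encodable S) := ⟨hS.toEncodable⟩
  let U : S → Set X := fun q => (chartAt (EuclideanSpace ℝ (Fin d)) (q : X)).source
  refine ⟨S, hS, fun q => U q \ ⋃ r : S, ⋃ _ : Encodable.encode r < Encodable.encode q, U r,
    fun q => ?_, fun q => sdiff_subset, ?_, ?_⟩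
  · refine (chartAt _ (q : X)).open_source.measurableSet.diff (MeasurableSet.iUnion fun r =>
      MeasurableSet.iUnion fun _ => (chartAt _ (r : X)).open_source.measurableSet)
  · intro a b hab
    rw [Function.onFun, Set.disjoint_left]
    rintro x ⟨hxa, hxa'⟩ ⟨hxb, hxb'⟩
    simp only [mem_iUnion, not_exists] at hxa' hxb'
    rcases lt_trichotomy (Encodable.encode a) (Encodable.encode b) with h | h | h
    · exact hxb' a h hxa
    · exact hab (Encodable.encode_injective h)
    · exact hxa' b h hxb
  · refine eq_univ_of_forall fun x => ?_
    have hx : ∃ n : ℕ, ∃ r : S, Encodable.encode r = n ∧ x ∈ U r := by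
      have hx : x ∈ ⋃ q ∈ S, (chartAt (EuclideanSpace ℝ (Fin d)) q).source := hcov ▸ mem_univ x
      simp only [mem_iUnion] at hx
      obtain ⟨q, hq, hxq⟩ := hx
      exact ⟨_, ⟨q, hq⟩, rfl, hxq⟩
    classical
    obtain ⟨r, hr, hxr⟩ := Nat.find_spec hx
    refine mem_iUnion.2 ⟨r, hxr, ?_⟩
    simp only [mem_iUnion, not_exists]
    intro r' hr' hxr'
    rw [hr] at hr'
    exact Nat.find_min hx hr' ⟨r', rfl, hxr'⟩

theorem riemVolume_apply [SecondCountableTopology X] (γ : RMetric d X) (q : X) {s : Set X}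
    (hs : MeasurableSet s) (hq : s ⊆ (chartAt (EuclideanSpace ℝ (Fin d)) q).source) :
    riemVolume γ s = chartVolume γ q s := by
  apply le_antisymm _ (le_iSup (chartVolume γ) q s)
  obtain ⟨S, hS, A, hA, hAs, hd, hU⟩ := exists_partition (d := d) (X := X)
  have : Countable S := hS
  let ν : Measure X := Measure.sum fun r : S => (chartVolume γ (r : X)).restrict (A r)
  have hν : ∀ (r : X) (t : Set X), MeasurableSet t →
      chartVolume γ r t ≤ ν t := by
    intro r t ht
    rw [Measure.sum_apply _ ht]
    have h0 : chartVolume γ r t = chartVolume γ r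
        (t ∩ (chartAt (EuclideanSpace ℝ (Fin d)) r).source) := by
      rw [chartVolume_apply γ r ht, chartVolume_apply γ r
        (ht.inter (chartAt (EuclideanSpace ℝ (Fin d)) r).open_source.measurableSet)]
      congr 2
      ext y
      simp only [mem_inter_iff, mem_preimage, and_congr_right_iff]
      intro hy
      have := (extChartAt (𝓡 d) r).map_target hy
      simp only [extChartAt_source] at this
      exact ⟨fun h => ⟨h, this⟩, fun h => h.1⟩
    rw [h0]
    set t' := t ∩ (chartAt (EuclideanSpace ℝ (Fin d)) r).source with ht'
    have ht'm : MeasurableSet t' :=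
      ht.inter (chartAt (EuclideanSpace ℝ (Fin d)) r).open_source.measurableSet
    have h1 : t' = ⋃ p : S, t' ∩ A p := by rw [← inter_iUnion, hU, inter_univ]
    calc chartVolume γ r t' ≤ ∑' p : S, chartVolume γ r (t' ∩ A p) := by
          conv_lhs => rw [h1]
          exact measure_iUnion_le _
      _ ≤ ∑' p : S, ((chartVolume γ (p : X)).restrict (A p)) t := by
          refine ENNReal.tsum_le_tsum fun p => ?_
          rw [Measure.restrict_apply ht, chartVolume_eq γ r p (ht'm.inter (hA p))
            (inter_subset_left.trans inter_subset_right) (inter_subset_right.trans (hAs p))]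
          exact measure_mono (inter_subset_inter_left _ inter_subset_left)
  have hle : riemVolume γ ≤ ν := iSup_le fun r => Measure.le_iff.2 (hν r)
  refine (hle s).trans ?_
  rw [Measure.sum_apply _ hs]
  calc ∑' p : S, ((chartVolume γ (p : X)).restrict (A p)) s
      = ∑' p : S, chartVolume γ q (s ∩ A p) := by
        refine tsum_congr fun p => ?_
        rw [Measure.restrict_apply hs, chartVolume_eq γ p q (hs.inter (hA p))
          (inter_subset_right.trans (hAs p)) (inter_subset_left.trans hq)]
    _ = chartVolume γ q (⋃ p : S, s ∩ A p) :=
        (measure_iUnion (fun a b hab => (hd hab).mono inter_subset_right inter_subset_right)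
          fun p => hs.inter (hA p)).symm
    _ ≤ chartVolume γ q s := measure_mono (iUnion_subset fun _ => inter_subset_left)

instance riemVolume_isLocallyFinite [SecondCountableTopology X] (γ : RMetric d X) :
    IsLocallyFiniteMeasure (riemVolume γ) where
  finiteAtNhds q := by
    have : LocallyCompactSpace X := ChartedSpace.locallyCompactSpace (EuclideanSpace ℝ (Fin d)) X
    set y₀ := extChartAt (𝓡 d) q q
    have hy₀ : y₀ ∈ (extChartAt (𝓡 d) q).target := mem_extChartAt_target q
    obtain ⟨K, hK, hy₀K, hKt⟩ := exists_compact_subset (isOpen_extChartAt_target (I := 𝓡 d) q) hy₀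
    have hcont : ContinuousOn (volDensity γ q) K := (continuousOn_volDensity γ q).mono hKt
    obtain ⟨C, hC⟩ := hK.exists_bound_of_continuousOn hcont
    let s : Set X := (extChartAt (𝓡 d) q).source ∩ (extChartAt (𝓡 d) q) ⁻¹' (interior K)
    have hso : IsOpen s :=
      (continuousOn_extChartAt q).isOpen_inter_preimage (isOpen_extChartAt_source q) isOpen_interior
    refine ⟨s, hso.mem_nhds ⟨mem_extChartAt_source q, hy₀K⟩, ?_⟩
    rw [riemVolume_apply γ q hso.measurableSet (by intro p hp; simpa using hp.1),
      chartVolume_apply γ q hso.measurableSet]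
    calc _ ≤ ∫⁻ y in K, ENNReal.ofReal (volDensity γ q y) := by
          refine lintegral_mono_set ?_
          rintro y ⟨hy, hy2⟩
          have := hy2.2
          rw [mem_preimage, (extChartAt (𝓡 d) q).right_inv hy] at this
          exact interior_subset this
      _ ≤ ∫⁻ y in K, ENNReal.ofReal C := by
          refine setLIntegral_mono' hK.measurableSet fun y hy => ?_
          exact ENNReal.ofReal_le_ofReal ((le_abs_self _).trans (hC y hy))
      _ < ⊤ := by
          rw [setLIntegral_const]
          exact ENNReal.mul_lt_top ENNReal.ofReal_lt_top hK.measure_lt_top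

end measure


theorem contMDiff_grad (γ : RMetric d X) {f : X → ℝ} (hf : ContMDiff (𝓡 d) 𝓘(ℝ) ∞ f) :
    ContMDiff (𝓡 d) (𝓡 d).tangent ∞ (fun p => (⟨p, grad γ f p⟩ : TangentBundle (𝓡 d) X)) :=
  contMDiff_sharp γ (contMDiff_mvfderiv hf)

theorem contMDiff_inner (γ : RMetric d X) {V W : ∀ p : X, TangentSpace (𝓡 d) p}
    (hV : ContMDiff (𝓡 d) (𝓡 d).tangent ∞ (fun p => (⟨p, V p⟩ : TangentBundle (𝓡 d) X)))
    (hW : ContMDiff (𝓡 d) (𝓡 d).tangent ∞ (fun p => (⟨p, W p⟩ : TangentBundle (𝓡 d) X))) :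
    ContMDiff (𝓡 d) 𝓘(ℝ) ∞ (fun p => γ.inner p (V p) (W p)) := by
  intro p
  have := ContMDiffAt.clm_bundle_apply₂ (F₁ := EuclideanSpace ℝ (Fin d))
    (F₂ := EuclideanSpace ℝ (Fin d)) (F₃ := ℝ) (E₃ := Bundle.Trivial X ℝ)
    (b := id) (γ.contMDiff p) (hV p) (hW p)
  rw [Bundle.contMDiffAt_totalSpace] at this
  exact this.2

end Riemannian

section Slice
variable {d : ℕ} {X : Type*} [TopologicalSpace X] [ChartedSpace (EuclideanSpace ℝ (Fin d)) X]
  [IsManifold (𝓡 d) ∞ X]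

/-- The geometric data on a slice `X`: Riemannian metric `γ`, lapse `α`, shift `β`. -/
structure SliceData (d : ℕ) (X : Type*) [TopologicalSpace X]
    [ChartedSpace (EuclideanSpace ℝ (Fin d)) X] [IsManifold (𝓡 d) ∞ X] where
  γ : RMetric d X
  α : X → ℝ
  β : ∀ p : X, TangentSpace (𝓡 d) p
  contMDiff_α : ContMDiff (𝓡 d) 𝓘(ℝ) ∞ α
  contMDiff_β : ContMDiff (𝓡 d) (𝓡 d).tangent ∞ (fun p => (⟨p, β p⟩ : TangentBundle (𝓡 d) X))
  α_pos : ∀ p, 0 < α p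
  β_lt : ∀ p, γ.inner p (β p) (β p) < α p ^ 2

/-- `C₀^∞(X)`: the smooth real functions of compact support. -/
def testFn (d : ℕ) (X : Type*) [TopologicalSpace X]
    [ChartedSpace (EuclideanSpace ℝ (Fin d)) X] : Submodule ℝ (X → ℝ) where
  carrier := {f | ContMDiff (𝓡 d) 𝓘(ℝ) ∞ f ∧ HasCompactSupport f}
  add_mem' hf hg := ⟨hf.1.add hg.1, hf.2.add hg.2⟩
  zero_mem' := ⟨contMDiff_const, HasCompactSupport.zero⟩
  smul_mem' c _ hf := ⟨ContMDiff.mul (f := fun _ => c) contMDiff_const hf.1, hf.2.smul_left (f := fun _ => c)⟩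

/-- `C₀^∞(X) ⊕ C₀^∞(X)`, the pairs `(φ, π)`; it will carry the energy norm of `S` and `m`. -/
def InitialData (_S : SliceData d X) (_m : ℝ) : Type _ := testFn d X × testFn d X

namespace InitialData
variable {S : SliceData d X} {m : ℝ}

instance : AddCommGroup (InitialData S m) := inferInstanceAs (AddCommGroup (testFn d X × testFn d X))
instance : Module ℝ (InitialData S m) := inferInstanceAs (Module ℝ (testFn d X × testFn d X))

/-- The field `φ`. -/
def fld (F : InitialData S m) : X → ℝ := F.1.1

/-- The momentum `π`. -/
def mom (F : InitialData S m) : X → ℝ := F.2.1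

/-- `D^a φ + (π / α) β^a`. -/
def vec (F : InitialData S m) (p : X) : TangentSpace (𝓡 d) p :=
  grad S.γ F.fld p + (F.mom p / S.α p) • S.β p

/-- The integrand of the (polarized) energy form, `2H(F) = ∫ energyDensity F F dγ`. -/
def energyDensity (F G : InitialData S m) (p : X) : ℝ :=
  S.α p * ((1 - S.γ.inner p (S.β p) (S.β p) / S.α p ^ 2) * (F.mom p * G.mom p)
    + S.γ.inner p (F.vec p) (G.vec p) + m ^ 2 * (F.fld p * G.fld p))

theorem contMDiff_fld (F : InitialData S m) : ContMDiff (𝓡 d) 𝓘(ℝ) ∞ F.fld := F.1.2.1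
theorem contMDiff_mom (F : InitialData S m) : ContMDiff (𝓡 d) 𝓘(ℝ) ∞ F.mom := F.2.2.1

theorem contMDiff_vec (F : InitialData S m) :
    ContMDiff (𝓡 d) (𝓡 d).tangent ∞ (fun p => (⟨p, F.vec p⟩ : TangentBundle (𝓡 d) X)) :=
  (contMDiff_grad S.γ F.contMDiff_fld).add_section
    ((F.contMDiff_mom.div₀ S.contMDiff_α fun p => (S.α_pos p).ne').smul_section S.contMDiff_β)

theorem continuous_energyDensity (F G : InitialData S m) : Continuous (energyDensity F G) := by
  have h1 := (contMDiff_inner S.γ F.contMDiff_vec G.contMDiff_vec).continuous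
  have h2 := (contMDiff_inner S.γ S.contMDiff_β S.contMDiff_β).continuous
  have h3 := S.contMDiff_α.continuous
  have h4 : Continuous fun p => S.γ.inner p (S.β p) (S.β p) / S.α p ^ 2 :=
    h2.div (h3.pow 2) fun p => (pow_pos (S.α_pos p) 2).ne'
  exact h3.mul ((((continuous_const.sub h4).mul
    (F.contMDiff_mom.continuous.mul G.contMDiff_mom.continuous)).add h1).add
    (continuous_const.mul (F.contMDiff_fld.continuous.mul G.contMDiff_fld.continuous)))

theorem hasCompactSupport_energyDensity [T2Space X] (F G : InitialData S m) :
    HasCompactSupport (energyDensity F G) := by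
  refine HasCompactSupport.intro (F.1.2.2.isCompact.union F.2.2.2.isCompact) fun p hp => ?_
  have h1 : p ∉ tsupport F.fld := fun h => hp (Or.inl h)
  have h2 : p ∉ tsupport F.mom := fun h => hp (Or.inr h)
  have h3 : F.fld p = 0 := image_eq_zero_of_notMem_tsupport h1
  have h4 : F.mom p = 0 := image_eq_zero_of_notMem_tsupport h2
  have h5 : mvfderiv (𝓡 d) F.fld p = 0 := by
    have : F.fld =ᶠ[𝓝 p] fun _ => (0 : ℝ) := notMem_tsupport_iff_eventuallyEq.1 h1
    rw [mvfderiv, this.mfderiv_eq, mfderiv_const]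
    rfl
  have h6 : F.vec p = 0 := by
    simp [vec, grad, sharp, h4, h5]
  simp [energyDensity, h3, h4, h6]

theorem vec_add (F G : InitialData S m) (p : X) : (F + G).vec p = F.vec p + G.vec p := by
  have h : mvfderiv (𝓡 d) (F + G).fld p = mvfderiv (𝓡 d) F.fld p + mvfderiv (𝓡 d) G.fld p :=
    mvfderiv_add (F.contMDiff_fld.mdifferentiableAt (by simp))
      (G.contMDiff_fld.mdifferentiableAt (by simp))
  have h' : (F + G).mom p = F.mom p + G.mom p := rfl
  simp only [vec, grad, sharp, h, h', map_add, add_div, add_smul]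
  abel

theorem vec_smul (c : ℝ) (F : InitialData S m) (p : X) : (c • F).vec p = c • F.vec p := by
  have h : mvfderiv (𝓡 d) (c • F).fld p = c • mvfderiv (𝓡 d) F.fld p := by
    have := mvfderiv_smul (a := fun _ => c) (x := p) mdifferentiableAt_const
      (F.contMDiff_fld.mdifferentiableAt (n := ∞) (by simp))
    rw [mvfderiv_const] at this
    refine Eq.trans this ?_
    ext v
    simp
  have h' : (c • F).mom p = c * F.mom p := rfl
  simp only [vec, grad, sharp, h, h', map_smul, mul_div_assoc, mul_smul, smul_add]

variable [T2Space X] [SecondCountableTopology X] [MeasurableSpace X] [BorelSpace X]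

theorem integrable_energyDensity (F G : InitialData S m) :
    Integrable (energyDensity F G) (riemVolume S.γ) :=
  (continuous_energyDensity F G).integrable_of_hasCompactSupport
    (hasCompactSupport_energyDensity F G)

/-- The energy form `⟨F, G⟩ = ∫ α ([1 - β²/α²] π π' + γ_ab v^a v'^b + m² φ φ') dγ`,
with `v = Dφ + (π/α) β`. -/
instance energyCore : PreInnerProductSpace.Core ℝ (InitialData S m) where
  inner F G := ∫ p, energyDensity F G p ∂(riemVolume S.γ)
  conj_inner_symm F G := by
    simp only [conj_trivial]
    refine integral_congr_ae (Filter.Eventually.of_forall fun p => ?_)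
    simp only [energyDensity, S.γ.symm p (G.vec p) (F.vec p)]
    ring
  re_inner_nonneg F := by
    simp only [RCLike.re_to_real]
    refine integral_nonneg fun p => ?_
    have h0 := S.α_pos p
    have h1 : S.γ.inner p (S.β p) (S.β p) / S.α p ^ 2 ≤ 1 :=
      (div_le_one (pow_pos h0 2)).2 (S.β_lt p).le
    have h2 : 0 ≤ S.γ.inner p (F.vec p) (F.vec p) := by
      by_cases h : F.vec p = 0
      · simp [h]
      · exact (S.γ.pos p _ h).le
    have h3 : 0 ≤ (1 - S.γ.inner p (S.β p) (S.β p) / S.α p ^ 2) * (F.mom p * F.mom p) :=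
      mul_nonneg (sub_nonneg.2 h1) (mul_self_nonneg _)
    have h4 : 0 ≤ m ^ 2 * (F.fld p * F.fld p) := mul_nonneg (sq_nonneg _) (mul_self_nonneg _)
    exact mul_nonneg h0.le (by linarith)
  add_left F F' G := by
    rw [← integral_add (integrable_energyDensity F G) (integrable_energyDensity F' G)]
    refine integral_congr_ae (Filter.Eventually.of_forall fun p => ?_)
    have h1 : (F + F').fld p = F.fld p + F'.fld p := rfl
    have h2 : (F + F').mom p = F.mom p + F'.mom p := rfl
    simp only [energyDensity, vec_add, h1, h2, map_add, add_apply]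
    ring
  smul_left F G c := by
    simp only [conj_trivial]
    rw [← integral_const_mul]
    refine integral_congr_ae (Filter.Eventually.of_forall fun p => ?_)
    have h1 : (c • F).fld p = c * F.fld p := rfl
    have h2 : (c • F).mom p = c * F.mom p := rfl
    simp only [energyDensity, vec_smul, h1, h2, map_smul, smul_apply, smul_eq_mul]
    ring

/-- The energy norm, `‖F‖² = 2H(F)`. -/
instance : SeminormedAddCommGroup (InitialData S m) :=
  InnerProductSpace.Core.toSeminormedAddCommGroup (𝕜 := ℝ)

instance : InnerProductSpace ℝ (InitialData S m) := InnerProductSpace.ofCore energyCore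

end InitialData

variable [T2Space X] [SecondCountableTopology X] [MeasurableSpace X] [BorelSpace X]

/-- The Hilbert space `H_A`: the completion of `C₀^∞(X) ⊕ C₀^∞(X)` in the energy norm. -/
abbrev EnergySpace (S : SliceData d X) (m : ℝ) : Type _ :=
  UniformSpace.Completion (InitialData S m)

/-! ### The operators on the slice -/

/-- The matrix differential operator
`𝒜 (φ, π) = (-(D^a α) D_a φ + α (m² - D^a D_a) φ - (D_a β^a) π - β^a D_a π, β^a D_a φ + α π)`. -/
def opA (S : SliceData d X) (m : ℝ) (u : (X → ℝ) × (X → ℝ)) : (X → ℝ) × (X → ℝ) :=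
  (fun p => -(mvfderiv (𝓡 d) u.1 p (grad S.γ S.α p))
      + S.α p * (m ^ 2 * u.1 p - laplacian S.γ u.1 p)
      - divergence S.γ S.β p * u.2 p - mvfderiv (𝓡 d) u.2 p (S.β p),
    fun p => mvfderiv (𝓡 d) u.1 p (S.β p) + S.α p * u.2 p)

/-- The symplectic matrix `j (φ, π) = (π, -φ)`. -/
def opJ (u : (X → ℝ) × (X → ℝ)) : (X → ℝ) × (X → ℝ) := (u.2, -u.1)

/-- The time-evolution operator `h = -j 𝒜`. -/
def opH (S : SliceData d X) (m : ℝ) (u : (X → ℝ) × (X → ℝ)) : (X → ℝ) × (X → ℝ) :=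
  -opJ (opA S m u)

/-- The symplectic form `σ(F, G) = ⟨F, j G⟩` of `L²(dγ) ⊕ L²(dγ)`, on smooth data of compact
support. -/
def sigma {S : SliceData d X} {m : ℝ} (F G : InitialData S m) : ℝ :=
  ∫ p, (F.fld p * (opJ (G.fld, G.mom)).1 p + F.mom p * (opJ (G.fld, G.mom)).2 p) ∂(riemVolume S.γ)

/-- The operator `A` on `H_A` extends `h`: for all `F` in `C₀^∞ ⊕ C₀^∞`, the pair `h F` is again in
`C₀^∞ ⊕ C₀^∞`, `F` is in the domain of `A`, and `A F = h F`. -/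
def ExtendsH {S : SliceData d X} {m : ℝ} (A : EnergySpace S m →ₗ.[ℝ] EnergySpace S m) : Prop :=
  ∀ F : InitialData S m, ∃ G : InitialData S m, (G.fld, G.mom) = opH S m (F.fld, F.mom) ∧
    ((F : EnergySpace S m), (G : EnergySpace S m)) ∈ A.graph

end Slice

section Spacetime
variable {d : ℕ} {M : Type*} [TopologicalSpace M]
  [ChartedSpace (EuclideanSpace ℝ (Fin (d + 1))) M] [IsManifold (𝓡 (d + 1)) ∞ M]
  {X : Type*} [TopologicalSpace X] [ChartedSpace (EuclideanSpace ℝ (Fin d)) X]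
  [IsManifold (𝓡 d) ∞ X]

/-- A stationary spacetime: a smooth Lorentzian metric `g` of signature `(-, +, …, +)` with an
everywhere timelike Killing field `K` whose orbits are complete, i.e. which generates a
one-parameter group `flow` of isometries. Time is oriented so that `K` is future directed. -/
structure StationarySpacetime (d : ℕ) (M : Type*) [TopologicalSpace M]
    [ChartedSpace (EuclideanSpace ℝ (Fin (d + 1))) M] [IsManifold (𝓡 (d + 1)) ∞ M] where
  g : ∀ x : M, TangentSpace (𝓡 (d + 1)) x →L[ℝ] TangentSpace (𝓡 (d + 1)) x →L[ℝ] ℝ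
  symm : ∀ x v w, g x v w = g x w v
  lorentzian : ∀ x, ∃ v, g x v v < 0 ∧ ∀ w, w ≠ 0 → g x v w = 0 → 0 < g x w w
  contMDiff_g : ContMDiff (𝓡 (d + 1)) ((𝓡 (d + 1)).prod 𝓘(ℝ, EuclideanSpace ℝ (Fin (d + 1)) →L[ℝ]
      EuclideanSpace ℝ (Fin (d + 1)) →L[ℝ] ℝ)) ∞
    (fun x => TotalSpace.mk' (EuclideanSpace ℝ (Fin (d + 1)) →L[ℝ]
      EuclideanSpace ℝ (Fin (d + 1)) →L[ℝ] ℝ) x (g x))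
  K : ∀ x : M, TangentSpace (𝓡 (d + 1)) x
  contMDiff_K : ContMDiff (𝓡 (d + 1)) (𝓡 (d + 1)).tangent ∞
    (fun x => (⟨x, K x⟩ : TangentBundle (𝓡 (d + 1)) M))
  timelike : ∀ x, g x (K x) (K x) < 0
  flow : ℝ → M → M
  contMDiff_flow : ContMDiff (𝓘(ℝ).prod (𝓡 (d + 1))) (𝓡 (d + 1)) ∞
    (fun z : ℝ × M => flow z.1 z.2)
  flow_zero : ∀ x, flow 0 x = x
  flow_add : ∀ s t x, flow (s + t) x = flow s (flow t x)
  isMIntegralCurve_flow : ∀ x, IsMIntegralCurve (fun t => flow t x) K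
  isometry_flow : ∀ t x v w, g (flow t x) (mfderiv (𝓡 (d + 1)) (𝓡 (d + 1)) (flow t) x v)
    (mfderiv (𝓡 (d + 1)) (𝓡 (d + 1)) (flow t) x w) = g x v w

/-- A smoothly embedded spatial hypersurface `Σ₀ = ι(X)` that meets each orbit of the Killing
field exactly once. Its translates `Σ_t = flow t (ι(X))` then foliate `M`. -/
structure SpatialSlice (N : StationarySpacetime d M) (X : Type*) [TopologicalSpace X]
    [ChartedSpace (EuclideanSpace ℝ (Fin d)) X] [IsManifold (𝓡 d) ∞ X] where
  ι : X → M
  isSmoothEmbedding : IsSmoothEmbedding (𝓡 d) (𝓡 (d + 1)) ∞ ι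
  spacelike : ∀ (p : X) (v : TangentSpace (𝓡 d) p), v ≠ 0 →
    0 < N.g (ι p) (mfderiv (𝓡 d) (𝓡 (d + 1)) ι p v) (mfderiv (𝓡 d) (𝓡 (d + 1)) ι p v)
  orbits : Function.Bijective (fun z : ℝ × X => N.flow z.1 (ι z.2))

theorem isVonNBounded_of_pos {p : X} (B : TangentSpace (𝓡 d) p →L[ℝ] TangentSpace (𝓡 d) p →L[ℝ] ℝ)
    (hB : ∀ v, v ≠ 0 → 0 < B v v) :
    Bornology.IsVonNBounded ℝ {v : TangentSpace (𝓡 d) p | B v v < 1} := by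
  change Bornology.IsVonNBounded ℝ (E := EuclideanSpace ℝ (Fin d))
    {v : EuclideanSpace ℝ (Fin d) | B v v < 1}
  let B' : EuclideanSpace ℝ (Fin d) →L[ℝ] EuclideanSpace ℝ (Fin d) →L[ℝ] ℝ := B
  change Bornology.IsVonNBounded ℝ (E := EuclideanSpace ℝ (Fin d))
    {v : EuclideanSpace ℝ (Fin d) | B' v v < 1}
  have hB' : ∀ v, v ≠ 0 → 0 < B' v v := hB
  clear_value B'
  rw [NormedSpace.isVonNBounded_iff]
  have hc : Continuous fun v => B' v v := by fun_prop
  obtain ⟨c, hc0, hcB⟩ : ∃ c : ℝ, 0 < c ∧ ∀ v, ‖v‖ = 1 → c ≤ B' v v := by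
    rcases (Metric.sphere (0 : EuclideanSpace ℝ (Fin d)) 1).eq_empty_or_nonempty with h | h
    · refine ⟨1, one_pos, fun v hv => ?_⟩
      have : v ∈ Metric.sphere (0 : EuclideanSpace ℝ (Fin d)) 1 := by simpa using hv
      rw [h] at this
      exact this.elim
    · obtain ⟨v, hv, hmin⟩ := (isCompact_sphere (0 : EuclideanSpace ℝ (Fin d)) 1).exists_isMinOn h
        hc.continuousOn
      refine ⟨B' v v, hB' v ?_, fun w hw => hmin (by simpa using hw)⟩
      rintro rfl
      simp at hv
  refine (Metric.isBounded_iff_subset_closedBall 0).2 ⟨Real.sqrt (1 / c), fun v hv => ?_⟩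
  rw [mem_closedBall_zero_iff]
  by_cases h0 : v = 0
  · simp [h0]
  have hn : 0 < ‖v‖ := norm_pos_iff.2 h0
  have h1 := hcB (‖v‖⁻¹ • v) (by rw [norm_smul, norm_inv, norm_norm, inv_mul_cancel₀ hn.ne'])
  simp only [map_smul, smul_apply, smul_eq_mul] at h1
  have hv' : B' v v < 1 := hv
  refine Real.le_sqrt_of_sq_le ?_
  rw [le_div_iff₀ hc0]
  have h2 : c * ‖v‖ ^ 2 ≤ B' v v := by
    have := mul_le_mul_of_nonneg_right h1 (sq_nonneg ‖v‖)
    refine this.trans_eq ?_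
    field_simp
  linarith

namespace SpatialSlice
variable {N : StationarySpacetime d M} (C : SpatialSlice N X)

/-- The differential of the embedding. -/
def dι (p : X) : TangentSpace (𝓡 d) p →L[ℝ] TangentSpace (𝓡 (d + 1)) (C.ι p) :=
  mfderiv (𝓡 d) (𝓡 (d + 1)) C.ι p

theorem contMDiff_dι_apply {V : ∀ p : X, TangentSpace (𝓡 d) p} {s : Set X} 
    (hV : ContMDiffOn (𝓡 d) (𝓡 d).tangent ∞ (fun p => (⟨p, V p⟩ : TangentBundle (𝓡 d) X)) s) :
    ContMDiffOn (𝓡 d) (𝓡 (d + 1)).tangent ∞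
      (fun p => (⟨C.ι p, C.dι p (V p)⟩ : TangentBundle (𝓡 (d + 1)) M)) s :=
  (C.isSmoothEmbedding.contMDiff.contMDiff_tangentMap (m := ∞) (by simp)).comp_contMDiffOn hV

theorem contMDiff_g_apply {V W : ∀ p : X, TangentSpace (𝓡 (d + 1)) (C.ι p)} {s : Set X} 
    (hV : ContMDiffOn (𝓡 d) (𝓡 (d + 1)).tangent ∞
      (fun p => (⟨C.ι p, V p⟩ : TangentBundle (𝓡 (d + 1)) M)) s)
    (hW : ContMDiffOn (𝓡 d) (𝓡 (d + 1)).tangent ∞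
      (fun p => (⟨C.ι p, W p⟩ : TangentBundle (𝓡 (d + 1)) M)) s) :
    ContMDiffOn (𝓡 d) 𝓘(ℝ) ∞ (fun p => N.g (C.ι p) (V p) (W p)) s := by
  intro p hp
  have := ContMDiffWithinAt.clm_bundle_apply₂ (F₁ := EuclideanSpace ℝ (Fin (d + 1)))
    (F₂ := EuclideanSpace ℝ (Fin (d + 1))) (F₃ := ℝ) (E₃ := Bundle.Trivial M ℝ)
    (b := C.ι) (((N.contMDiff_g _).comp p (C.isSmoothEmbedding.contMDiff p)).contMDiffWithinAt)
      (hV p hp) (hW p hp)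
  rw [Bundle.contMDiffWithinAt_totalSpace] at this
  exact this.2

/-- The pullback `ι^* g` at a point. -/
def pullback (p : X) : TangentSpace (𝓡 d) p →L[ℝ] TangentSpace (𝓡 d) p →L[ℝ] ℝ :=
  (ContinuousLinearMap.precomp ℝ (C.dι p)) ∘L (N.g (C.ι p)) ∘L (C.dι p)

theorem pullback_apply (p : X) (v w : TangentSpace (𝓡 d) p) :
    C.pullback p v w = N.g (C.ι p) (C.dι p v) (C.dι p w) := rfl

theorem pullback_pos (p : X) (v : TangentSpace (𝓡 d) p) (hv : v ≠ 0) : 0 < C.pullback p v v :=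
  C.spacelike p v hv

/-- The Riemannian metric `γ = ι^* g` induced on the slice. -/
def inducedMetric : RMetric d X where
  inner := C.pullback
  symm _ _ _ := N.symm _ _ _
  pos := C.pullback_pos
  isVonNBounded p := isVonNBounded_of_pos (C.pullback p) (C.pullback_pos p)
  contMDiff := contMDiff_bilin fun q v w =>
    C.contMDiff_g_apply (C.contMDiff_dι_apply (contMDiffOn_frame q v))
      (C.contMDiff_dι_apply (contMDiffOn_frame q w))

/-- The covector `β_a`, the restriction of `g(K, ·)` to the slice. -/
def shiftCovector (p : X) : TangentSpace (𝓡 d) p →L[ℝ] ℝ :=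
  N.g (C.ι p) (N.K (C.ι p)) ∘L C.dι p

/-- The shift vector `β`, the projection of `K` to the slice. -/
def shift (p : X) : TangentSpace (𝓡 d) p := sharp C.inducedMetric p (C.shiftCovector p)

/-- The lapse `α`, with `-α² + β² = g(K, K)`. -/
def lapse (p : X) : ℝ :=
  Real.sqrt (C.inducedMetric.inner p (C.shift p) (C.shift p) - N.g (C.ι p) (N.K (C.ι p)) (N.K (C.ι p)))

/-- The unit normal `n` of the slice. -/
def normal (p : X) : TangentSpace (𝓡 (d + 1)) (C.ι p) :=
  (C.lapse p)⁻¹ • (N.K (C.ι p) - C.dι p (C.shift p))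

theorem inner_shift_nonneg (p : X) : 0 ≤ C.inducedMetric.inner p (C.shift p) (C.shift p) := by
  by_cases h : C.shift p = 0
  · simp [h]
  · exact (C.inducedMetric.pos p _ h).le

theorem lapse_pos (p : X) : 0 < C.lapse p :=
  Real.sqrt_pos.2 (by linarith [C.inner_shift_nonneg p, N.timelike (C.ι p)])

theorem lapse_sq (p : X) : C.lapse p ^ 2 =
    C.inducedMetric.inner p (C.shift p) (C.shift p) - N.g (C.ι p) (N.K (C.ι p)) (N.K (C.ι p)) :=
  Real.sq_sqrt (by linarith [C.inner_shift_nonneg p, N.timelike (C.ι p)])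

theorem g_K_dι (p : X) (v : TangentSpace (𝓡 d) p) :
    N.g (C.ι p) (N.K (C.ι p)) (C.dι p v) = N.g (C.ι p) (C.dι p (C.shift p)) (C.dι p v) :=
  (congrArg (fun l => l v) (inner_sharp C.inducedMetric p (C.shiftCovector p))).symm

/-- Lapse and shift are the ones of the decomposition `K = α n + β`, where `n` is the
future-directed unit normal and `β` is tangent to the slice. -/
theorem lapse_shift_spec (p : X) :
    N.K (C.ι p) = C.lapse p • C.normal p + C.dι p (C.shift p) ∧
    N.g (C.ι p) (C.normal p) (C.normal p) = -1 ∧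
    (∀ v, N.g (C.ι p) (C.normal p) (C.dι p v) = 0) ∧
    N.g (C.ι p) (C.normal p) (N.K (C.ι p)) < 0 := by
  have ha := C.lapse_pos p
  have hsq := C.lapse_sq p
  have hin : C.inducedMetric.inner p (C.shift p) (C.shift p) =
    N.g (C.ι p) (C.dι p (C.shift p)) (C.dι p (C.shift p)) := rfl
  have hK := C.g_K_dι p
  have hK' := hK (C.shift p)
  have hs := N.symm (C.ι p) (C.dι p (C.shift p)) (N.K (C.ι p))
  rw [hin] at hsq
  refine ⟨?_, ?_, ?_, ?_⟩
  · simp [normal, smul_smul, mul_inv_cancel₀ ha.ne']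
  · simp only [normal, map_smul, map_sub, smul_apply, sub_apply, smul_eq_mul]
    field_simp
    linarith
  · intro v
    simp [normal, hK v]
  · simp only [normal, map_smul, map_sub, smul_apply, sub_apply, smul_eq_mul]
    refine mul_neg_of_pos_of_neg (inv_pos.2 ha) ?_
    have := pow_pos ha 2
    linarith

theorem contMDiff_shift : ContMDiff (𝓡 d) (𝓡 d).tangent ∞
    (fun p => (⟨p, C.shift p⟩ : TangentBundle (𝓡 d) X)) :=
  contMDiff_sharp _ (contMDiff_covector fun q v => C.contMDiff_g_apply
    ((N.contMDiff_K.comp C.isSmoothEmbedding.contMDiff).contMDiffOn)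
    (C.contMDiff_dι_apply (contMDiffOn_frame q v)))

theorem contMDiff_lapse : ContMDiff (𝓡 d) 𝓘(ℝ) ∞ C.lapse := by
  have h1 := contMDiff_inner C.inducedMetric C.contMDiff_shift C.contMDiff_shift
  have h2 : ContMDiff (𝓡 d) 𝓘(ℝ) ∞ fun p => N.g (C.ι p) (N.K (C.ι p)) (N.K (C.ι p)) := by
    have := (N.contMDiff_K.comp C.isSmoothEmbedding.contMDiff).contMDiffOn (s := univ)
    exact contMDiffOn_univ.1 (C.contMDiff_g_apply this this)
  intro p
  have h3 := (h1.sub h2) p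
  refine ContMDiffAt.comp (I' := 𝓘(ℝ)) p (g := Real.sqrt) ?_ h3
  refine (Real.contDiffAt_sqrt ?_).contMDiffAt
  have := C.lapse_sq p
  exact (this ▸ pow_pos (C.lapse_pos p) 2).ne'

/-- The metric, lapse and shift induced on the slice. -/
def data : SliceData d X where
  γ := C.inducedMetric
  α := C.lapse
  β := C.shift
  contMDiff_α := C.contMDiff_lapse
  contMDiff_β := C.contMDiff_shift
  α_pos := C.lapse_pos
  β_lt p := by linarith [C.lapse_sq p, N.timelike (C.ι p)]

end SpatialSlice
end Spacetime

section Operators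
variable {H : Type*} [NormedAddCommGroup H] [InnerProductSpace ℝ H] [CompleteSpace H]

/-- A densely defined operator `A` is skew-adjoint if `A† = -A` (with equal domains). -/
def IsSkewAdjointOp (A : H →ₗ.[ℝ] H) : Prop :=
  Dense (A.domain : Set H) ∧ A.adjoint = -A

/-- `U t = e^{-At}`: the strongly continuous one-parameter group of isometries whose generator
is exactly `-A`. -/
structure IsEvolution (A : H →ₗ.[ℝ] H) (U : ℝ → H →L[ℝ] H) : Prop where
  zero : ∀ Φ, U 0 Φ = Φ
  add : ∀ s t Φ, U (s + t) Φ = U s (U t Φ)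
  norm_map : ∀ t Φ, ‖U t Φ‖ = ‖Φ‖
  continuous : ∀ Φ, Continuous fun t => U t Φ
  generator : ∀ Φ Ψ, HasDerivAt (fun t => U t Φ) (-Ψ) 0 ↔ (Φ, Ψ) ∈ A.graph

end Operators
end StationaryKG
end

/-!
The bound `α - β²/α ≥ ε` and `m² > 0` make the energy density dominate a multiple of `φ² + π²`, so
`σ` is bounded on the energy space and represented there by a bounded skew-adjoint operator `T`.
Integration by parts gives `σ(G, h F) = ⟨G, F⟩`, that is, `T (h F) = F`. Hence `T` has dense range;
being skew-adjoint it is injective, and `T⁻¹` is a skew-adjoint extension of `h`. The group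
`e^{-tT⁻¹}` is the strong limit, as `s ↓ 0`, of the exponentials of the bounded skew-adjoint
operators `-t T (T² - s)⁻¹`, which commute with `T`; since `σ(Φ, Ψ) = ⟨Φ, T Ψ⟩` and the group is
isometric, it conserves `σ`.
-/

noncomputable section
namespace StationaryKG

/-! ### Bounded skew-adjoint operators and their inverses -/

section InverseOp
variable {H : Type*} [NormedAddCommGroup H] [InnerProductSpace ℝ H]

/-- The inverse `T⁻¹` of an injective bounded operator, as an unbounded operator with domain
`Ran T`; for non-injective `T` it is a junk value. -/
def inverseOp (T : H →L[ℝ] H) : H →ₗ.[ℝ] H := (T.toLinearMap.toPMap ⊤).inverse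

variable {T : H →L[ℝ] H}

theorem mem_graph_inverseOp (hT : Function.Injective T) {x y : H} :
    (x, y) ∈ (inverseOp T).graph ↔ T y = x := by
  rw [inverseOp, LinearPMap.inverse_graph]
  · simp [LinearPMap.mem_graph_iff]
  · exact LinearMap.ker_eq_bot.2 fun a b h => Subtype.ext (hT h)

theorem coe_domain_inverseOp (hT : Function.Injective T) :
    ((inverseOp T).domain : Set H) = range T := by
  ext x
  simp [LinearPMap.mem_domain_iff, mem_graph_inverseOp hT]

theorem IsEvolution.inner_map_map {A : H →ₗ.[ℝ] H} {U : ℝ → H →L[ℝ] H}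
    (hU : IsEvolution A U) (t : ℝ) (x y : H) : inner ℝ (U t x) (U t y) = inner ℝ x y :=
  (LinearMap.norm_map_iff_inner_map_map (𝕜 := ℝ) (U t)).1 (hU.norm_map t) x y

end InverseOp

section Skew
variable {H : Type*} [NormedAddCommGroup H] [InnerProductSpace ℝ H] [CompleteSpace H]

theorem exists_skewAdjoint_of_antisymm (b : H →L[ℝ] H →L[ℝ] ℝ) (hb : ∀ x y, b x y = -b y x) :
    ∃ T ∈ skewAdjoint (H →L[ℝ] H), ∀ x y, b x y = inner ℝ x (T y) := by
  let T := InnerProductSpace.continuousLinearMapOfBilin (𝕜 := ℝ) b.flip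
  have hT (x y : H) : b x y = inner ℝ x (T y) := by
    rw [real_inner_comm]
    exact (InnerProductSpace.continuousLinearMapOfBilin_apply b.flip y x).symm
  refine ⟨T, skewAdjoint.mem_iff.2 (Eq.symm ?_), hT⟩
  refine (ContinuousLinearMap.eq_adjoint_iff _ _).2 fun x y => ?_
  rw [neg_apply, inner_neg_left, real_inner_comm, ← hT, ← hT, hb x y]

variable {T : H →L[ℝ] H}

theorem inner_map_left_of_mem_skewAdjoint (hT : T ∈ skewAdjoint (H →L[ℝ] H)) (x y : H) :
    inner ℝ (T x) y = -inner ℝ x (T y) := by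
  rw [← ContinuousLinearMap.adjoint_inner_right, ← ContinuousLinearMap.star_eq_adjoint,
    skewAdjoint.mem_iff.1 hT, neg_apply, inner_neg_right]

theorem injective_of_mem_skewAdjoint (hT : T ∈ skewAdjoint (H →L[ℝ] H)) (hd : DenseRange T) :
    Function.Injective T := by
  refine (injective_iff_map_eq_zero T).2 fun x hx => Dense.eq_zero_of_inner_left ℝ hd ?_
  rintro _ ⟨y, rfl⟩
  rw [← neg_inj, ← inner_map_left_of_mem_skewAdjoint hT, hx, inner_zero_left, neg_zero]

theorem isSkewAdjointOp_inverseOp (hT : T ∈ skewAdjoint (H →L[ℝ] H)) (hd : DenseRange T) :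
    IsSkewAdjointOp (inverseOp T) := by
  have hi := injective_of_mem_skewAdjoint hT hd
  have hdom : Dense ((inverseOp T).domain : Set H) := by rwa [coe_domain_inverseOp hi]
  refine ⟨hdom, LinearPMap.eq_of_eq_graph ?_⟩
  ext ⟨x, y⟩
  have hneg : (x, y) ∈ (-inverseOp T).graph ↔ T (-y) = x := by
    rw [← mem_graph_inverseOp hi, LinearPMap.neg_graph]
    simp [LinearPMap.mem_graph_iff, neg_eq_iff_eq_neg]
  rw [hneg, LinearPMap.adjoint_graph_eq_graph_adjoint hdom, Submodule.mem_adjoint_iff]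
  simp only [mem_graph_inverseOp hi]
  constructor
  · intro h
    refine ext_inner_left ℝ fun v => ?_
    have hv := h (T v) v rfl
    rw [inner_map_left_of_mem_skewAdjoint hT] at hv
    rw [map_neg, inner_neg_right]
    linarith
  · rintro rfl _ v rfl
    rw [inner_map_left_of_mem_skewAdjoint hT, map_neg, inner_neg_right, sub_self]

end Skew

/-! ### Strong limits of exponentials of skew-adjoint operators -/

section Exponential
variable {H : Type*} [NormedAddCommGroup H] [InnerProductSpace ℝ H] [CompleteSpace H]

theorem exp_smul_mem_unitary {B : H →L[ℝ] H} (hB : B ∈ skewAdjoint (H →L[ℝ] H)) (t : ℝ) :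
    NormedSpace.exp (t • B) ∈ unitary (H →L[ℝ] H) :=
  let _ : NormedAlgebra ℚ (H →L[ℝ] H) := NormedAlgebra.restrictScalars ℚ ℝ _
  NormedSpace.exp_mem_unitary_of_mem_skewAdjoint (skewAdjoint.smul_mem t hB)

theorem norm_exp_smul_apply {B : H →L[ℝ] H} (hB : B ∈ skewAdjoint (H →L[ℝ] H)) (t : ℝ) (x : H) :
    ‖NormedSpace.exp (t • B) x‖ = ‖x‖ :=
  ContinuousLinearMap.norm_map_of_mem_unitary (exp_smul_mem_unitary hB t) x

theorem hasDerivAt_exp_smul_apply {E : Type*} [NormedAddCommGroup E] [NormedSpace ℝ E]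
    [CompleteSpace E] (B : E →L[ℝ] E) (x : E) (t : ℝ) :
    HasDerivAt (fun t : ℝ => NormedSpace.exp (t • B) x) (NormedSpace.exp (t • B) (B x)) t :=
  (ContinuousLinearMap.apply ℝ E x).hasFDerivAt.comp_hasDerivAt t
    (hasDerivAt_exp_smul_const (𝕂 := ℝ) B t)

theorem norm_exp_smul_apply_sub_le {B : H →L[ℝ] H} (hB : B ∈ skewAdjoint (H →L[ℝ] H)) (t : ℝ)
    (x : H) : ‖NormedSpace.exp (t • B) x - x‖ ≤ ‖B x‖ * |t| := by
  simpa using convex_univ.norm_image_sub_le_of_norm_hasDerivWithin_le (C := ‖B x‖)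
    (fun s _ => (hasDerivAt_exp_smul_apply B x s).hasDerivWithinAt)
    (fun s _ => (norm_exp_smul_apply hB s (B x)).le) (mem_univ 0) (mem_univ t)

theorem norm_exp_smul_sub_exp_smul_le {B B' : H →L[ℝ] H} (hB : B ∈ skewAdjoint (H →L[ℝ] H))
    (hB' : B' ∈ skewAdjoint (H →L[ℝ] H)) (hc : Commute B B') (t : ℝ) (x : H) :
    ‖NormedSpace.exp (t • B) x - NormedSpace.exp (t • B') x‖ ≤ ‖B x - B' x‖ * |t| := by
  have hfactor : NormedSpace.exp (t • B) =
      NormedSpace.exp (t • B') * NormedSpace.exp (t • (B - B')) := by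
    let _ : NormedAlgebra ℚ (H →L[ℝ] H) := NormedAlgebra.restrictScalars ℚ ℝ _
    rw [← NormedSpace.exp_add_of_commute, ← smul_add, add_sub_cancel]
    exact ((hc.symm.sub_right (Commute.refl B')).smul_left t).smul_right t
  rw [hfactor, mul_apply_eq_comp, ← map_sub, norm_exp_smul_apply hB']
  exact norm_exp_smul_apply_sub_le (sub_mem hB hB') t x

theorem uniformCauchySeqOn_of_dense {ι E F : Type*} [NormedAddCommGroup E] [NormedSpace ℝ E]
    [NormedAddCommGroup F] [NormedSpace ℝ F]
    {f : ℕ → ι → E →L[ℝ] F} {s : Set ι} {D : Set E} (hD : Dense D)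
    (hf : ∀ n i x, ‖f n i x‖ ≤ ‖x‖)
    (h : ∀ x ∈ D, UniformCauchySeqOn (fun n i => f n i x) Filter.atTop s) (x : E) :
    UniformCauchySeqOn (fun n i => f n i x) Filter.atTop s := by
  rw [Metric.uniformCauchySeqOn_iff]
  intro ε hε
  obtain ⟨y, hxy, hy⟩ := Metric.dense_iff.1 hD x (ε / 3) (by positivity)
  rw [Metric.mem_ball, dist_comm, dist_eq_norm] at hxy
  obtain ⟨n, hn⟩ := Metric.uniformCauchySeqOn_iff.1 (h y hy) (ε / 3) (by positivity)
  refine ⟨n, fun k hk l hl i hi => ?_⟩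
  have happrox (j : ℕ) : dist (f j i x) (f j i y) < ε / 3 := by
    rw [dist_eq_norm, ← map_sub]
    exact (hf j i _).trans_lt hxy
  calc dist (f k i x) (f l i x)
      ≤ dist (f k i x) (f k i y) + dist (f k i y) (f l i y) + dist (f l i y) (f l i x) :=
        dist_triangle4 _ _ _ _
    _ < ε := by linarith [happrox k, hn k hk l hl i hi, dist_comm (f l i y) (f l i x), happrox l]

/-- `U t` is the strong limit of the unitary groups `exp (t B n)`, locally uniformly in `t`. -/
structure IsExpLimit (B : ℕ → H →L[ℝ] H) (U : ℝ → H →L[ℝ] H) : Prop where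
  skew : ∀ n, B n ∈ skewAdjoint (H →L[ℝ] H)
  tendsto : ∀ x, TendstoLocallyUniformly (fun n t => NormedSpace.exp (t • B n) x)
    (fun t => U t x) Filter.atTop

theorem uniformCauchySeqOn_exp_smul_apply {B : ℕ → H →L[ℝ] H}
    (hB : ∀ n, B n ∈ skewAdjoint (H →L[ℝ] H)) (hc : ∀ k l, Commute (B k) (B l)) {x : H}
    (hx : CauchySeq fun n => B n x) (r : ℝ) :
    UniformCauchySeqOn (fun n t => NormedSpace.exp (t • B n) x) Filter.atTop
      (Metric.ball (0 : ℝ) r) := by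
  rw [Metric.uniformCauchySeqOn_iff]
  intro ε hε
  obtain ⟨n, hn⟩ := Metric.cauchySeq_iff.1 hx (ε / (|r| + 1)) (by positivity)
  refine ⟨n, fun k hk l hl t ht => ?_⟩
  have ht : |t| ≤ |r| + 1 := by
    rw [mem_ball_zero_iff, Real.norm_eq_abs] at ht
    linarith [le_abs_self r]
  have hkl := hn k hk l hl
  rw [dist_eq_norm, lt_div_iff₀ (by positivity)] at hkl
  calc dist (NormedSpace.exp (t • B k) x) (NormedSpace.exp (t • B l) x)
      ≤ ‖B k x - B l x‖ * |t| :=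
        (dist_eq_norm _ _).trans_le (norm_exp_smul_sub_exp_smul_le (hB k) (hB l) (hc k l) t x)
    _ ≤ ‖B k x - B l x‖ * (|r| + 1) := by gcongr
    _ < ε := hkl

theorem exists_isExpLimit {B : ℕ → H →L[ℝ] H} (hB : ∀ n, B n ∈ skewAdjoint (H →L[ℝ] H))
    (hc : ∀ k l, Commute (B k) (B l)) {D : Set H} (hD : Dense D)
    (hx : ∀ x ∈ D, CauchySeq fun n => B n x) : ∃ U, IsExpLimit B U := by
  have hcauchy (x : H) (r : ℝ) := uniformCauchySeqOn_of_dense hD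
    (f := fun n (t : ℝ) => NormedSpace.exp (t • B n)) (s := Metric.ball 0 r)
    (fun n t x => (norm_exp_smul_apply (hB n) t x).le)
    (fun x hxD => uniformCauchySeqOn_exp_smul_apply hB hc (hx x hxD) r) x
  have hmem (t : ℝ) : t ∈ Metric.ball 0 (|t| + 1) := by simp
  choose u hu using fun (t : ℝ) (x : H) => cauchySeq_tendsto_of_complete
    ((hcauchy x (|t| + 1)).cauchySeq (hmem t))
  let L (t : ℝ) : H →ₗ[ℝ] H := linearMapOfTendsto (u t)
    (fun n => (NormedSpace.exp (t • B n)).toLinearMap) (tendsto_pi_nhds.2 (hu t))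
  have hL (t : ℝ) (x : H) : ‖L t x‖ ≤ 1 * ‖x‖ := by
    rw [one_mul]
    exact le_of_tendsto (hu t x).norm
      (Filter.Eventually.of_forall fun n => (norm_exp_smul_apply (hB n) t x).le)
  refine ⟨fun t => (L t).mkContinuous 1 (hL t), hB, fun x V hV t => ?_⟩
  exact ⟨Metric.ball 0 (|t| + 1), Metric.isOpen_ball.mem_nhds (hmem t),
    (hcauchy x (|t| + 1)).tendstoUniformlyOn_of_tendsto (fun s _ => hu s x) V hV⟩

variable {B : ℕ → H →L[ℝ] H} {U : ℝ → H →L[ℝ] H}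

namespace IsExpLimit

theorem tendsto_apply (hU : IsExpLimit B U) (t : ℝ) (x : H) :
    Filter.Tendsto (fun n => NormedSpace.exp (t • B n) x) Filter.atTop (𝓝 (U t x)) :=
  (tendstoLocallyUniformlyOn_univ.2 (hU.tendsto x)).tendsto_at (mem_univ t)

theorem norm_map (hU : IsExpLimit B U) (t : ℝ) (x : H) : ‖U t x‖ = ‖x‖ := by
  refine tendsto_nhds_unique (hU.tendsto_apply t x).norm ?_
  simp only [norm_exp_smul_apply (hU.skew _), tendsto_const_nhds_iff]

theorem zero_apply (hU : IsExpLimit B U) (x : H) : U 0 x = x := by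
  refine tendsto_nhds_unique (hU.tendsto_apply 0 x) ?_
  simp

theorem continuous_apply (hU : IsExpLimit B U) (x : H) : Continuous fun t => U t x :=
  (hU.tendsto x).continuous <| Filter.Eventually.frequently <| Filter.Eventually.of_forall
    fun n => continuous_iff_continuousAt.2 fun t =>
      (hasDerivAt_exp_smul_apply (B n) x t).continuousAt

theorem map_commute (hU : IsExpLimit B U) {T : H →L[ℝ] H} (hT : ∀ n, Commute T (B n)) (t : ℝ)
    (x : H) : U t (T x) = T (U t x) := by
  refine tendsto_nhds_unique (hU.tendsto_apply t (T x)) ?_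
  refine ((T.continuous.tendsto _).comp (hU.tendsto_apply t x)).congr fun n => ?_
  exact congr($((((hT n).smul_right t).exp_right).eq) x)

theorem tendsto_exp_smul_of_tendsto (hU : IsExpLimit B U) {y : ℕ → H} {z : H}
    (hy : Filter.Tendsto y Filter.atTop (𝓝 z)) :
    TendstoLocallyUniformly (fun n t => NormedSpace.exp (t • B n) (y n)) (fun t => U t z)
      Filter.atTop := by
  have hdiff : TendstoLocallyUniformly (fun n t => NormedSpace.exp (t • B n) (y n - z))
      (fun _ : ℝ => 0) Filter.atTop := by
    refine TendstoUniformly.tendstoLocallyUniformly (Metric.tendstoUniformly_iff.2 fun ε hε => ?_)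
    filter_upwards [Metric.tendsto_nhds.1 hy ε hε] with n hn t
    rwa [dist_zero_left, norm_exp_smul_apply (hU.skew n), ← dist_eq_norm]
  convert hdiff.add (hU.tendsto z) using 1 <;> ext <;> simp

theorem map_add (hU : IsExpLimit B U) (s t : ℝ) (x : H) : U (s + t) x = U s (U t x) := by
  refine tendsto_nhds_unique (hU.tendsto_apply (s + t) x) ?_
  refine ((tendstoLocallyUniformlyOn_univ.2 (hU.tendsto_exp_smul_of_tendsto
    (hU.tendsto_apply t x))).tendsto_at (mem_univ s)).congr fun n => ?_
  let _ : NormedAlgebra ℚ (H →L[ℝ] H) := NormedAlgebra.restrictScalars ℚ ℝ _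
  rw [add_smul, NormedSpace.exp_add_of_commute (((Commute.refl (B n)).smul_left s).smul_right t)]
  rfl

theorem hasDerivAt (hU : IsExpLimit B U) {x y : H}
    (hxy : Filter.Tendsto (fun n => B n x) Filter.atTop (𝓝 y)) (t : ℝ) :
    HasDerivAt (fun t => U t x) (U t y) t :=
  hasDerivAt_of_tendstoLocallyUniformlyOn isOpen_univ
    (tendstoLocallyUniformlyOn_univ.2 (hU.tendsto_exp_smul_of_tendsto hxy))
    (Filter.Eventually.of_forall fun n t _ => hasDerivAt_exp_smul_apply (B n) x t)
    (fun t _ => hU.tendsto_apply t x) (mem_univ t)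

theorem isEvolution_inverseOp (hU : IsExpLimit B U) {T : H →L[ℝ] H} (hi : Function.Injective T)
    (hT : ∀ n, Commute T (B n))
    (hB : ∀ y, Filter.Tendsto (fun n => B n (T y)) Filter.atTop (𝓝 (-y))) :
    IsEvolution (inverseOp T) U where
  zero := hU.zero_apply
  add := hU.map_add
  norm_map := hU.norm_map
  continuous := hU.continuous_apply
  generator x y := by
    have hderiv (z : H) : HasDerivAt (fun t => U t (T z)) (-z) 0 := by
      simpa only [hU.zero_apply] using hU.hasDerivAt (hB z) 0
    rw [mem_graph_inverseOp hi]
    constructor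
    · intro h
      have hTh : HasDerivAt (fun t => U t (T x)) (T (-y)) 0 := by
        simpa only [hU.map_commute hT, Function.comp_def] using T.hasFDerivAt.comp_hasDerivAt 0 h
      exact neg_injective ((map_neg T y).symm.trans (hTh.unique (hderiv x)))
    · rintro rfl
      exact hderiv y

end IsExpLimit
end Exponential

/-! ### The group generated by the inverse of a skew-adjoint operator -/

section Yosida
variable {H : Type*} [NormedAddCommGroup H] [InnerProductSpace ℝ H] [CompleteSpace H]
  {T : H →L[ℝ] H}

theorem norm_smul_sub_map_map_sq (hT : T ∈ skewAdjoint (H →L[ℝ] H)) (s : ℝ) (w : H) :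
    ‖s • w - T (T w)‖ ^ 2 = s ^ 2 * ‖w‖ ^ 2 + 2 * s * ‖T w‖ ^ 2 + ‖T (T w)‖ ^ 2 := by
  have hinner : inner ℝ w (T (T w)) = -‖T w‖ ^ 2 := by
    rw [← real_inner_self_eq_norm_sq, inner_map_left_of_mem_skewAdjoint hT, neg_neg]
  rw [norm_sub_sq_real, inner_smul_left, hinner, norm_smul, mul_pow, Real.norm_eq_abs, sq_abs,
    RCLike.conj_to_real]
  ring

theorem isUnit_smul_one_sub_mul_self (hT : T ∈ skewAdjoint (H →L[ℝ] H)) {s : ℝ} (hs : 0 < s) :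
    IsUnit (s • (1 : H →L[ℝ] H) - T * T) := by
  refine ContinuousLinearMap.isUnit_of_forall_le_norm_inner_map _ (c := ⟨s, hs.le⟩) hs fun x => ?_
  have hcoercive : inner ℝ ((s • (1 : H →L[ℝ] H) - T * T) x) x = s * ‖x‖ ^ 2 + ‖T x‖ ^ 2 := by
    simp [inner_sub_left, inner_smul_left, inner_map_left_of_mem_skewAdjoint hT (T x) x]
  refine le_trans ?_ (le_abs_self _)
  rw [hcoercive, mul_comm]
  exact le_add_of_nonneg_right (sq_nonneg ‖T x‖)

/-- `(s - T²)⁻¹`, the resolvent of `T²` at `s`. -/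
def sqResolvent (T : H →L[ℝ] H) (s : ℝ) : H →L[ℝ] H :=
  Ring.inverse (s • (1 : H →L[ℝ] H) - T * T)

theorem smul_sqResolvent_sub (hT : T ∈ skewAdjoint (H →L[ℝ] H)) {s : ℝ} (hs : 0 < s) (x : H) :
    s • sqResolvent T s x - T (T (sqResolvent T s x)) = x :=
  congr($(Ring.mul_inverse_cancel _ (isUnit_smul_one_sub_mul_self hT hs)) x)

theorem commute_sqResolvent (hT : T ∈ skewAdjoint (H →L[ℝ] H)) {s : ℝ} (hs : 0 < s)
    {A : H →L[ℝ] H} (hA : Commute A T) : Commute A (sqResolvent T s) := by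
  have hcomm : Commute A (s • (1 : H →L[ℝ] H) - T * T) :=
    ((Commute.one_right A).smul_right s).sub_right (hA.mul_right hA)
  obtain ⟨u, hu⟩ := isUnit_smul_one_sub_mul_self hT hs
  rw [← hu] at hcomm
  rw [sqResolvent, ← hu, Ring.inverse_unit]
  exact hcomm.units_inv_right

theorem sqResolvent_map (hT : T ∈ skewAdjoint (H →L[ℝ] H)) {s : ℝ} (hs : 0 < s) (x : H) :
    sqResolvent T s (T x) = T (sqResolvent T s x) :=
  congr($((commute_sqResolvent hT hs (Commute.refl T)).eq.symm) x)

theorem norm_smul_sqResolvent_le (hT : T ∈ skewAdjoint (H →L[ℝ] H)) {s : ℝ} (hs : 0 < s) (z : H) :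
    ‖s • sqResolvent T s z‖ ≤ ‖z‖ := by
  have h := norm_smul_sub_map_map_sq hT s (sqResolvent T s z)
  rw [smul_sqResolvent_sub hT hs] at h
  refine le_of_sq_le_sq ?_ (norm_nonneg z)
  rw [h, norm_smul, mul_pow, Real.norm_eq_abs, sq_abs, add_assoc]
  exact le_add_of_nonneg_right (by positivity)

theorem norm_smul_sqResolvent_map_le (hT : T ∈ skewAdjoint (H →L[ℝ] H)) {s : ℝ} (hs : 0 < s)
    (z : H) : ‖s • sqResolvent T s (T z)‖ ≤ √s * ‖z‖ := by
  have h := norm_smul_sub_map_map_sq hT s (sqResolvent T s z)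
  rw [smul_sqResolvent_sub hT hs] at h
  have hsq : s * ‖T (sqResolvent T s z)‖ ^ 2 ≤ ‖z‖ ^ 2 := by
    rw [h]
    nlinarith [sq_nonneg (s * ‖sqResolvent T s z‖), sq_nonneg ‖T (T (sqResolvent T s z))‖,
      mul_nonneg hs.le (sq_nonneg ‖T (sqResolvent T s z)‖)]
  refine le_of_sq_le_sq ?_ (by positivity)
  rw [sqResolvent_map hT hs, norm_smul, Real.norm_of_nonneg hs.le, mul_pow, mul_pow,
    Real.sq_sqrt hs.le, sq s, mul_assoc]
  gcongr

theorem tendsto_smul_sqResolvent (hT : T ∈ skewAdjoint (H →L[ℝ] H)) (hd : DenseRange T)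
    {s : ℕ → ℝ} (hs : ∀ n, 0 < s n) (hs0 : Filter.Tendsto s Filter.atTop (𝓝 0)) (x : H) :
    Filter.Tendsto (fun n => s n • sqResolvent T (s n) x) Filter.atTop (𝓝 0) := by
  have hequi : Equicontinuous fun n x => s n • sqResolvent T (s n) x := by
    refine (LipschitzWith.uniformEquicontinuous _ 1 fun n => ?_).equicontinuous
    refine LipschitzWith.of_dist_le_mul fun x y => ?_
    rw [dist_eq_norm, ← smul_sub, ← map_sub, NNReal.coe_one, one_mul, dist_eq_norm]
    exact norm_smul_sqResolvent_le hT (hs n) _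
  refine hd.induction_on x
    (hequi.isClosed_setOfPred_tendsto (f := fun _ => 0) continuous_const) fun y => ?_
  have hsqrt : Filter.Tendsto (fun n => √(s n) * ‖y‖) Filter.atTop (𝓝 0) := by
    simpa using ((Real.continuous_sqrt.tendsto 0).comp hs0).mul_const ‖y‖
  exact squeeze_zero_norm (fun n => norm_smul_sqResolvent_map_le hT (hs n) y) hsqrt

/-- The bounded operator `T (s - T²)⁻¹`, which approximates `-T⁻¹` as `s → 0`. -/
def yosida (T : H →L[ℝ] H) (s : ℝ) : H →L[ℝ] H := T * sqResolvent T s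

theorem yosida_mem_skewAdjoint (hT : T ∈ skewAdjoint (H →L[ℝ] H)) {s : ℝ} (hs : 0 < s) :
    yosida T s ∈ skewAdjoint (H →L[ℝ] H) := by
  have hstar : star (sqResolvent T s) = sqResolvent T s := by
    rw [sqResolvent, ← Ring.inverse_star]
    simp [skewAdjoint.mem_iff.1 hT]
  rw [skewAdjoint.mem_iff, yosida, star_mul, hstar, skewAdjoint.mem_iff.1 hT, mul_neg,
    (commute_sqResolvent hT hs (Commute.refl T)).eq]

theorem commute_yosida (hT : T ∈ skewAdjoint (H →L[ℝ] H)) {s : ℝ} (hs : 0 < s)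
    {A : H →L[ℝ] H} (hA : Commute A T) : Commute A (yosida T s) :=
  hA.mul_right (commute_sqResolvent hT hs hA)

theorem yosida_map (hT : T ∈ skewAdjoint (H →L[ℝ] H)) {s : ℝ} (hs : 0 < s) (y : H) :
    yosida T s (T y) = s • sqResolvent T s y - y := by
  rw [yosida, mul_apply_eq_comp, sqResolvent_map hT hs, eq_sub_iff_add_eq',
    ← eq_sub_iff_add_eq, smul_sqResolvent_sub hT hs]

theorem exists_isEvolution_inverseOp (hT : T ∈ skewAdjoint (H →L[ℝ] H)) (hd : DenseRange T) :
    ∃ U, IsEvolution (inverseOp T) U ∧ ∀ t x, U t (T x) = T (U t x) := by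
  let s (n : ℕ) : ℝ := 1 / ((n : ℝ) + 1)
  have hs (n : ℕ) : 0 < s n := Nat.one_div_pos_of_nat
  have hlim (y : H) : Filter.Tendsto (fun n => yosida T (s n) (T y)) Filter.atTop (𝓝 (-y)) := by
    simp only [yosida_map hT (hs _)]
    simpa using (tendsto_smul_sqResolvent hT hd hs tendsto_one_div_add_atTop_nhds_zero_nat
      y).sub_const y
  have hcomm (n : ℕ) : Commute T (yosida T (s n)) := commute_yosida hT (hs n) (Commute.refl T)
  obtain ⟨U, hU⟩ := exists_isExpLimit (fun n => yosida_mem_skewAdjoint hT (hs n))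
    (fun k l => commute_yosida hT (hs l) (hcomm k).symm) hd
    (by rintro _ ⟨y, rfl⟩; exact (hlim y).cauchySeq)
  exact ⟨U, hU.isEvolution_inverseOp (injective_of_mem_skewAdjoint hT hd) hcomm hlim,
    hU.map_commute hcomm⟩

end Yosida

/-! ### The metric, vector fields and functions in charts -/

section Charts

theorem eq_sum_smul_single {ι : Type*} [Fintype ι] [DecidableEq ι] (v : EuclideanSpace ℝ ι) :
    v = ∑ i, v i • EuclideanSpace.single i (1 : ℝ) := by
  ext j; simp [Pi.single_apply]

variable {d : ℕ} {X : Type*} [TopologicalSpace X] [ChartedSpace (EuclideanSpace ℝ (Fin d)) X]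

theorem mvfderiv_eq_zero_of_notMem_tsupport {f : X → ℝ} {p : X} (hp : p ∉ tsupport f) :
    mvfderiv (𝓡 d) f p = 0 := by
  have h0 : f =ᶠ[𝓝 p] fun _ => (0 : ℝ) := notMem_tsupport_iff_eventuallyEq.1 hp
  rw [mvfderiv, h0.mfderiv_eq, mfderiv_const]
  rfl

theorem support_mvfderiv_apply_subset (f : X → ℝ) (V : ∀ p : X, TangentSpace (𝓡 d) p) :
    Function.support (fun p => mvfderiv (𝓡 d) f p (V p)) ⊆ tsupport f := fun p hp => by
  by_contra h
  exact hp (by simp only [mvfderiv_eq_zero_of_notMem_tsupport h, zero_apply])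

variable [IsManifold (𝓡 d) ∞ X]

/-- Smoothness of a vector field, as a section of the tangent bundle. -/
abbrev IsSmoothVectorField (V : ∀ p : X, TangentSpace (𝓡 d) p) : Prop :=
  ContMDiff (𝓡 d) (𝓡 d).tangent ∞ (fun p => (⟨p, V p⟩ : TangentBundle (𝓡 d) X))

theorem frame_eq_sum (q p : X) (v : EuclideanSpace ℝ (Fin d)) :
    frame q v p = ∑ i, v i • frame q (EuclideanSpace.single i 1) p := by
  conv_lhs => rw [eq_sum_smul_single v]
  simp only [frame, map_sum, map_smul]

theorem frame_injective {q p : X} (hp : p ∈ (chartAt (EuclideanSpace ℝ (Fin d)) q).source) :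
    Function.Injective fun v : EuclideanSpace ℝ (Fin d) => frame q v p := by
  have hp' : p ∈ (trivializationAt (EuclideanSpace ℝ (Fin d)) (TangentSpace (𝓡 d)) q).baseSet := by
    simpa using hp
  exact Function.LeftInverse.injective (g := (trivializationAt (EuclideanSpace ℝ (Fin d))
    (TangentSpace (𝓡 d)) q).continuousLinearMapAt ℝ p) fun v =>
      Bundle.Trivialization.continuousLinearMapAt_symmL _ hp' v

theorem gramAt_posDef (γ : RMetric d X) {q p : X}
    (hp : p ∈ (chartAt (EuclideanSpace ℝ (Fin d)) q).source) : (gramAt γ q p).PosDef := by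
  refine Matrix.PosDef.of_dotProduct_mulVec_pos ?_ fun x hx => ?_
  · ext i j
    simpa [gramAt] using γ.symm _ _ _
  · have hne : frame q (WithLp.toLp 2 x) p ≠ 0 := by
      have h0 : frame q (0 : EuclideanSpace ℝ (Fin d)) p = 0 := by simp [frame]
      rw [← h0]
      exact (frame_injective hp).ne (by simpa using hx)
    refine (γ.pos p _ hne).trans_eq ?_
    rw [frame_eq_sum]
    simp only [map_sum, map_smul, sum_apply, smul_apply, smul_eq_mul, dotProduct, Matrix.mulVec,
      gramAt, Matrix.of_apply, star_trivial, Finset.mul_sum, frame]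
    rw [Finset.sum_comm]
    exact Finset.sum_congr rfl fun k _ => Finset.sum_congr rfl fun l _ => by ring

theorem volDensity_pos (γ : RMetric d X) (q : X) {y : EuclideanSpace ℝ (Fin d)}
    (hy : y ∈ (extChartAt (𝓡 d) q).target) : 0 < volDensity γ q y := by
  rw [volDensity, gram_eq γ q hy]
  exact Real.sqrt_pos.2 (gramAt_posDef γ
    (by simpa using (extChartAt (𝓡 d) q).map_target hy)).det_pos

theorem contDiffOn_comp_chart_symm {F : Type*} [NormedAddCommGroup F] [NormedSpace ℝ F] {q : X}
    {f : X → F} (hf : ContMDiffOn (𝓡 d) 𝓘(ℝ, F) ∞ f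
      (chartAt (EuclideanSpace ℝ (Fin d)) q).source) :
    ContDiffOn ℝ ∞ (fun y => f ((extChartAt (𝓡 d) q).symm y)) (extChartAt (𝓡 d) q).target := by
  rw [← contMDiffOn_iff_contDiffOn]
  refine hf.comp (contMDiffOn_extChartAt_symm q) fun y hy => ?_
  simpa using (extChartAt (𝓡 d) q).map_target hy

theorem contDiffOn_volDensity (γ : RMetric d X) (q : X) :
    ContDiffOn ℝ ∞ (volDensity γ q) (extChartAt (𝓡 d) q).target := by
  have hdet : ContDiffOn ℝ ∞ (fun y => (gramAt γ q ((extChartAt (𝓡 d) q).symm y)).det)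
      (extChartAt (𝓡 d) q).target := by
    simp only [Matrix.det_apply]
    refine ContDiffOn.sum fun σ _ => ContDiffOn.const_smul _ (contDiffOn_prod fun i _ => ?_)
    exact contDiffOn_comp_chart_symm (contMDiffOn_gramAt γ q _ _)
  refine (hdet.sqrt fun y hy => ?_).congr fun y hy => by rw [volDensity, gram_eq γ q hy]
  exact (gramAt_posDef γ (by simpa using (extChartAt (𝓡 d) q).map_target hy)).det_pos.ne'

theorem contDiffOn_coordComp {V : ∀ p : X, TangentSpace (𝓡 d) p} (hV : IsSmoothVectorField V)
    (q : X) (i : Fin d) :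
    ContDiffOn ℝ ∞ (fun y => coordComp V q y i) (extChartAt (𝓡 d) q).target := by
  set e := trivializationAt (EuclideanSpace ℝ (Fin d)) (TangentSpace (𝓡 d) (M := X)) q
  have he : ContMDiffOn (𝓡 d) 𝓘(ℝ, EuclideanSpace ℝ (Fin d)) ∞ (fun p => (e ⟨p, V p⟩).2)
      e.baseSet := e.contMDiffOn_section_baseSet_iff.1 hV.contMDiffOn
  refine ((EuclideanSpace.proj i : EuclideanSpace ℝ (Fin d) →L[ℝ] ℝ).contDiff.comp_contDiffOn
    (contDiffOn_comp_chart_symm (q := q) (he.mono (by simp [e])))).congr fun y hy => ?_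
  have hp : (extChartAt (𝓡 d) q).symm y ∈ (chartAt (EuclideanSpace ℝ (Fin d)) q).source := by
    simpa using (extChartAt (𝓡 d) q).map_target hy
  have h := congrArg (fun L => L (V ((extChartAt (𝓡 d) q).symm y)))
    (TangentBundle.continuousLinearMapAt_trivializationAt (𝕜 := ℝ) (I := 𝓡 d) hp)
  rw [Bundle.Trivialization.continuousLinearMapAt_apply,
    Bundle.Trivialization.linearMapAt_apply, if_pos (by simpa using hp)] at h
  exact congrArg (fun v : EuclideanSpace ℝ (Fin d) => v i) h.symm

theorem mvfderiv_eq_fderiv_comp_extChartAt {f : X → ℝ} (hf : ContMDiff (𝓡 d) 𝓘(ℝ) ∞ f) {q p : X}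
    (hp : p ∈ (extChartAt (𝓡 d) q).source) (v : TangentSpace (𝓡 d) p) :
    mvfderiv (𝓡 d) f p v = fderiv ℝ (fun z => f ((extChartAt (𝓡 d) q).symm z))
      (extChartAt (𝓡 d) q p) (mvfderiv (𝓡 d) (extChartAt (𝓡 d) q) p v) := by
  set g : EuclideanSpace ℝ (Fin d) → ℝ := fun z => f ((extChartAt (𝓡 d) q).symm z)
  have hg : DifferentiableAt ℝ g (extChartAt (𝓡 d) q p) :=
    ((contDiffOn_comp_chart_symm hf.contMDiffOn).contDiffAt
      ((isOpen_extChartAt_target q).mem_nhds ((extChartAt (𝓡 d) q).map_source hp))).differentiableAt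
        (by simp)
  have hfg : f =ᶠ[𝓝 p] g ∘ extChartAt (𝓡 d) q := by
    filter_upwards [(isOpen_extChartAt_source (I := 𝓡 d) q).mem_nhds hp] with r hr
    simp only [g, Function.comp_apply, (extChartAt (𝓡 d) q).left_inv hr]
  have hchain := mfderiv_comp p hg.mdifferentiableAt
    (mdifferentiableAt_extChartAt (I := 𝓡 d) (by simpa using hp))
  rw [mfderiv_eq_fderiv] at hchain
  exact congrArg (fun L => L v) (hfg.mfderiv_eq.trans hchain)

theorem mvfderiv_eq_sum {f : X → ℝ} (hf : ContMDiff (𝓡 d) 𝓘(ℝ) ∞ f)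
    (V : ∀ p : X, TangentSpace (𝓡 d) p) (q : X) {y : EuclideanSpace ℝ (Fin d)}
    (hy : y ∈ (extChartAt (𝓡 d) q).target) :
    mvfderiv (𝓡 d) f ((extChartAt (𝓡 d) q).symm y) (V ((extChartAt (𝓡 d) q).symm y)) =
      ∑ i, coordComp V q y i * fderiv ℝ (fun z => f ((extChartAt (𝓡 d) q).symm z)) y
        (EuclideanSpace.single i 1) := by
  rw [mvfderiv_eq_fderiv_comp_extChartAt hf ((extChartAt (𝓡 d) q).map_target hy),
    (extChartAt (𝓡 d) q).right_inv hy,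
    eq_sum_smul_single (mvfderiv (𝓡 d) (extChartAt (𝓡 d) q) _ _)]
  simp only [map_sum, map_smul, smul_eq_mul]
  rfl

theorem contMDiff_mvfderiv_apply {f : X → ℝ} (hf : ContMDiff (𝓡 d) 𝓘(ℝ) ∞ f)
    {V : ∀ p : X, TangentSpace (𝓡 d) p} (hV : IsSmoothVectorField V) :
    ContMDiff (𝓡 d) 𝓘(ℝ) ∞ (fun p => mvfderiv (𝓡 d) f p (V p)) := by
  intro p
  have h := ContMDiffAt.clm_bundle_apply (F₁ := EuclideanSpace ℝ (Fin d)) (F₂ := ℝ)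
    (E₁ := fun p : X => TangentSpace (𝓡 d) p) (E₂ := Bundle.Trivial X ℝ) (b := id)
    (contMDiff_mvfderiv hf p) (hV p)
  rw [Bundle.contMDiffAt_totalSpace] at h
  exact h.2

end Charts
/-! ### Integration by parts in a Euclidean domain -/

theorem integrable_mul_of_tsupport_subset {Y : Type*} [TopologicalSpace Y] [MeasurableSpace Y]
    [OpensMeasurableSpace Y] {μ : Measure Y} [IsFiniteMeasureOnCompacts μ] {Ω : Set Y}
    (hΩ : IsOpen Ω) {W F : Y → ℝ} (hW : ContinuousOn W Ω) (hF : Continuous F)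
    (hc : HasCompactSupport F) (hs : tsupport F ⊆ Ω) : Integrable (fun x => W x * F x) μ := by
  have hWF : Continuous (fun x => W x * F x) :=
    continuous_of_tsupport fun x hx => (hW.mul hF.continuousOn).continuousAt
      (hΩ.mem_nhds (hs (closure_mono (Function.support_mul_subset_right W F) hx)))
  exact hWF.integrable_of_hasCompactSupport hc.mul_left

section Euclidean
variable {E : Type*} [NormedAddCommGroup E] [NormedSpace ℝ E] [FiniteDimensional ℝ E]
  [MeasurableSpace E] [BorelSpace E] {μ : Measure E} [μ.IsAddHaarMeasure]

theorem integral_sum_fderiv_mul_eq_neg {ι : Type*} [Fintype ι] {Ω : Set E} (hΩ : IsOpen Ω)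
    {W : ι → E → ℝ} (hW : ∀ i, ContDiffOn ℝ 1 (W i) Ω) {F : E → ℝ} (hF : ContDiff ℝ 1 F)
    (hc : HasCompactSupport F) (hs : tsupport F ⊆ Ω) (v : ι → E) :
    ∫ x, (∑ i, fderiv ℝ (W i) x (v i)) * F x ∂μ =
      -∫ x, ∑ i, W i x * fderiv ℝ F x (v i) ∂μ := by
  have hint : ∀ i, Integrable (fun x => W i x * fderiv ℝ F x (v i)) μ := fun i =>
    integrable_mul_of_tsupport_subset hΩ (hW i).continuousOn
      ((hF.continuous_fderiv one_ne_zero).clm_apply continuous_const) (hc.fderiv_apply ℝ (v i))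
      ((tsupport_fderiv_apply_subset ℝ (v i)).trans hs)
  have hint' : ∀ i, Integrable (fun x => fderiv ℝ (W i) x (v i) * F x) μ := fun i =>
    integrable_mul_of_tsupport_subset hΩ
      (((hW i).continuousOn_fderiv_of_isOpen hΩ le_rfl).clm_apply continuousOn_const)
      hF.continuous hc hs
  have hibp : ∀ i, ∫ x, W i x * fderiv ℝ F x (v i) ∂μ = -∫ x, fderiv ℝ (W i) x (v i) * F x ∂μ :=
    fun i => integral_mul_fderiv_eq_neg_fderiv_mul_of_integrable (hint' i) (hint i)
      (integrable_mul_of_tsupport_subset hΩ (hW i).continuousOn hF.continuous hc hs)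
      (fun x hx => ((hW i).contDiffAt (hΩ.mem_nhds (hs hx))).differentiableAt one_ne_zero)
      fun x _ => hF.differentiable one_ne_zero x
  simp only [Finset.sum_mul]
  rw [integral_finsetSum _ fun i _ => hint' i, integral_finsetSum _ fun i _ => hint i]
  simp only [hibp, Finset.sum_neg_distrib, neg_neg]

end Euclidean

/-! ### The divergence theorem -/

section Extension
variable {d : ℕ} {X : Type*} [TopologicalSpace X] [ChartedSpace (EuclideanSpace ℝ (Fin d)) X]

/-- The function `f` read in the chart at `q` and extended by zero; meant for `f` supported in the
chart domain. -/
def chartExtend (q : X) (f : X → ℝ) : EuclideanSpace ℝ (Fin d) → ℝ :=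
  (extChartAt (𝓡 d) q).target.indicator fun y => f ((extChartAt (𝓡 d) q).symm y)

theorem chartExtend_eventuallyEq {q : X} (f : X → ℝ) {y : EuclideanSpace ℝ (Fin d)}
    (hy : y ∈ (extChartAt (𝓡 d) q).target) :
    chartExtend q f =ᶠ[𝓝 y] fun z => f ((extChartAt (𝓡 d) q).symm z) := by
  filter_upwards [(isOpen_extChartAt_target (I := 𝓡 d) q).mem_nhds hy] with z hz
  rw [chartExtend, indicator_of_mem hz]

theorem isCompact_image_tsupport {q : X} {f : X → ℝ} (hc : HasCompactSupport f)
    (hs : tsupport f ⊆ (chartAt (EuclideanSpace ℝ (Fin d)) q).source) :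
    IsCompact (extChartAt (𝓡 d) q '' tsupport f) :=
  hc.isCompact.image_of_continuousOn ((continuousOn_extChartAt q).mono (by simpa using hs))

theorem image_tsupport_subset {q : X} {f : X → ℝ}
    (hs : tsupport f ⊆ (chartAt (EuclideanSpace ℝ (Fin d)) q).source) :
    extChartAt (𝓡 d) q '' tsupport f ⊆ (extChartAt (𝓡 d) q).target := by
  rintro _ ⟨p, hp, rfl⟩
  exact (extChartAt (𝓡 d) q).map_source (by simpa using hs hp)

theorem support_chartExtend_subset (q : X) (f : X → ℝ) :
    Function.support (chartExtend q f) ⊆ extChartAt (𝓡 d) q '' tsupport f := by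
  intro y hy
  have hyT : y ∈ (extChartAt (𝓡 d) q).target := mem_of_indicator_ne_zero hy
  rw [Function.mem_support, chartExtend, indicator_of_mem hyT] at hy
  exact ⟨_, subset_tsupport f hy, (extChartAt (𝓡 d) q).right_inv hyT⟩

theorem hasCompactSupport_chartExtend {q : X} {f : X → ℝ} (hc : HasCompactSupport f)
    (hs : tsupport f ⊆ (chartAt (EuclideanSpace ℝ (Fin d)) q).source) :
    HasCompactSupport (chartExtend (d := d) q f) :=
  HasCompactSupport.of_support_subset_isCompact (isCompact_image_tsupport hc hs)
    (support_chartExtend_subset q f)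

theorem tsupport_chartExtend_subset {q : X} {f : X → ℝ} (hc : HasCompactSupport f)
    (hs : tsupport f ⊆ (chartAt (EuclideanSpace ℝ (Fin d)) q).source) :
    tsupport (chartExtend (d := d) q f) ⊆ (extChartAt (𝓡 d) q).target :=
  (closure_minimal (support_chartExtend_subset q f) (isCompact_image_tsupport hc hs).isClosed).trans
    (image_tsupport_subset hs)

theorem contDiff_chartExtend [IsManifold (𝓡 d) ∞ X] {q : X} {f : X → ℝ}
    (hf : ContMDiff (𝓡 d) 𝓘(ℝ) ∞ f) (hc : HasCompactSupport f)
    (hs : tsupport f ⊆ (chartAt (EuclideanSpace ℝ (Fin d)) q).source) :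
    ContDiff ℝ ∞ (chartExtend (d := d) q f) := by
  rw [contDiff_iff_contDiffAt]
  intro y
  by_cases hy : y ∈ (extChartAt (𝓡 d) q).target
  · exact ((contDiffOn_comp_chart_symm hf.contMDiffOn).contDiffAt
      ((isOpen_extChartAt_target q).mem_nhds hy)).congr_of_eventuallyEq
        (chartExtend_eventuallyEq f hy)
  · exact contDiffAt_const.congr_of_eventuallyEq (notMem_tsupport_iff_eventuallyEq.1
      fun h => hy (tsupport_chartExtend_subset hc hs h))

end Extension

section Divergence
variable {d : ℕ} {X : Type*} [TopologicalSpace X] [ChartedSpace (EuclideanSpace ℝ (Fin d)) X]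
  [IsManifold (𝓡 d) ∞ X]

/-- The vector density `(det γ)^{1/2} V^i` in the chart at `q`. -/
def densityComp (γ : RMetric d X) (V : ∀ p : X, TangentSpace (𝓡 d) p) (q : X) (i : Fin d)
    (y : EuclideanSpace ℝ (Fin d)) : ℝ :=
  volDensity γ q y * coordComp V q y i

/-- The divergence of `V` at `p` computed in the chart at `q`, whereas `divergence` takes the
preferred chart at `p` itself. -/
def chartDiv (γ : RMetric d X) (V : ∀ p : X, TangentSpace (𝓡 d) p) (q p : X) : ℝ :=
  (volDensity γ q (extChartAt (𝓡 d) q p))⁻¹ *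
    ∑ i, fderiv ℝ (densityComp γ V q i) (extChartAt (𝓡 d) q p) (EuclideanSpace.single i 1)

variable {V : ∀ p : X, TangentSpace (𝓡 d) p}

theorem contDiffOn_densityComp (γ : RMetric d X) (hV : IsSmoothVectorField V) (q : X) (i : Fin d) :
    ContDiffOn ℝ ∞ (densityComp γ V q i) (extChartAt (𝓡 d) q).target :=
  (contDiffOn_volDensity γ q).mul (contDiffOn_coordComp hV q i)

theorem contMDiffOn_chartDiv (γ : RMetric d X) (hV : IsSmoothVectorField V) (q : X) :
    ContMDiffOn (𝓡 d) 𝓘(ℝ) ∞ (chartDiv γ V q) (chartAt (EuclideanSpace ℝ (Fin d)) q).source := by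
  have h : ContDiffOn ℝ ∞ (fun y => (volDensity γ q y)⁻¹ *
      ∑ i, fderiv ℝ (densityComp γ V q i) y (EuclideanSpace.single i 1))
      (extChartAt (𝓡 d) q).target := by
    refine ((contDiffOn_volDensity γ q).inv fun y hy => (volDensity_pos γ q hy).ne').mul
      (ContDiffOn.sum fun i _ => ?_)
    exact ((contDiffOn_densityComp γ hV q i).fderiv_of_isOpen (isOpen_extChartAt_target q)
      (by simp)).clm_apply contDiffOn_const
  refine h.contMDiffOn.comp (contMDiffOn_extChartAt (I := 𝓡 d) (x := q)) fun p hp => ?_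
  exact (extChartAt (𝓡 d) q).map_source (by simpa using hp)

theorem volDensity_mul_chartExtend_mul_chartDiv (γ : RMetric d X) (q : X) (f : X → ℝ)
    (y : EuclideanSpace ℝ (Fin d)) :
    volDensity γ q y * chartExtend q (fun p => f p * chartDiv γ V q p) y =
      (∑ i, fderiv ℝ (densityComp γ V q i) y (EuclideanSpace.single i 1)) * chartExtend q f y := by
  by_cases hy : y ∈ (extChartAt (𝓡 d) q).target
  · have hρ := (volDensity_pos γ q hy).ne'
    simp only [chartExtend, indicator_of_mem hy, chartDiv, (extChartAt (𝓡 d) q).right_inv hy]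
    field_simp
  · simp only [chartExtend, indicator_of_notMem hy, mul_zero]

theorem volDensity_mul_chartExtend_mvfderiv (γ : RMetric d X) {q : X} {f : X → ℝ}
    (hf : ContMDiff (𝓡 d) 𝓘(ℝ) ∞ f) (hc : HasCompactSupport f)
    (hs : tsupport f ⊆ (chartAt (EuclideanSpace ℝ (Fin d)) q).source)
    (y : EuclideanSpace ℝ (Fin d)) :
    volDensity γ q y * chartExtend q (fun p => mvfderiv (𝓡 d) f p (V p)) y =
      ∑ i, densityComp γ V q i y * fderiv ℝ (chartExtend q f) y (EuclideanSpace.single i 1) := by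
  by_cases hy : y ∈ (extChartAt (𝓡 d) q).target
  · rw [(chartExtend_eventuallyEq f hy).fderiv_eq, chartExtend, indicator_of_mem hy,
      mvfderiv_eq_sum hf V q hy, Finset.mul_sum]
    simp only [densityComp, mul_assoc]
  · have h0 : fderiv ℝ (chartExtend q f) y = 0 := image_eq_zero_of_notMem_tsupport fun h =>
      hy (tsupport_chartExtend_subset hc hs (tsupport_fderiv_subset ℝ h))
    rw [h0, chartExtend, indicator_of_notMem hy]
    simp

section Integral
variable [SecondCountableTopology X] [MeasurableSpace X] [BorelSpace X]

theorem riemVolume_restrict_chart (γ : RMetric d X) (q : X) :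
    (riemVolume γ).restrict (chartAt (EuclideanSpace ℝ (Fin d)) q).source = chartVolume γ q := by
  ext s hs
  have hm := (chartAt (EuclideanSpace ℝ (Fin d)) q).open_source.measurableSet
  rw [Measure.restrict_apply hs, riemVolume_apply γ q (hs.inter hm) inter_subset_right,
    chartVolume_apply γ q hs, chartVolume_apply γ q (hs.inter hm)]
  congr 2
  ext y
  simp only [mem_inter_iff, mem_preimage, and_congr_right_iff, and_iff_left_iff_imp]
  intro hy _
  simpa using (extChartAt (𝓡 d) q).map_target hy

theorem integral_riemVolume_eq_chart (γ : RMetric d X) {q : X} {g : X → ℝ}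
    (hg : ContinuousOn g (chartAt (EuclideanSpace ℝ (Fin d)) q).source)
    (hs : Function.support g ⊆ (chartAt (EuclideanSpace ℝ (Fin d)) q).source) :
    ∫ p, g p ∂(riemVolume γ) = ∫ y, volDensity γ q y * chartExtend q g y := by
  have hT : MeasurableSet (extChartAt (𝓡 d) q).target := (isOpen_extChartAt_target q).measurableSet
  have hae := hg.aestronglyMeasurable (μ := riemVolume γ)
    (chartAt (EuclideanSpace ℝ (Fin d)) q).open_source.measurableSet
  have hsymm : AEMeasurable (extChartAt (𝓡 d) q).symm
      (volume.restrict (extChartAt (𝓡 d) q).target) :=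
    (continuousOn_extChartAt_symm q).aemeasurable hT
  have hρ : AEMeasurable (fun y => ENNReal.ofReal (volDensity γ q y))
      (volume.restrict (extChartAt (𝓡 d) q).target) :=
    ((continuousOn_volDensity γ q).aemeasurable hT).ennreal_ofReal
  rw [← setIntegral_eq_integral_of_forall_compl_eq_zero fun p hp =>
    Function.notMem_support.1 fun h => hp (hs h)]
  rw [riemVolume_restrict_chart] at hae ⊢
  rw [chartVolume, integral_map (hsymm.mono_ac (withDensity_absolutelyContinuous _ _)) hae,
    integral_withDensity_eq_integral_toReal_smul₀ hρ (by simp)]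
  simp only [chartExtend, ← indicator_mul_right]
  rw [integral_indicator hT]
  refine setIntegral_congr_fun hT fun y hy => ?_
  simp only [ENNReal.toReal_ofReal (volDensity_pos γ q hy).le, smul_eq_mul]

instance riemVolume_isOpenPos (γ : RMetric d X) : (riemVolume γ).IsOpenPosMeasure where
  open_pos U hU := by
    rintro ⟨q, hq⟩ h0
    set Uq := U ∩ (chartAt (EuclideanSpace ℝ (Fin d)) q).source
    have hUq : IsOpen Uq := hU.inter (chartAt (EuclideanSpace ℝ (Fin d)) q).open_source
    set B := (extChartAt (𝓡 d) q).target ∩ (extChartAt (𝓡 d) q).symm ⁻¹' Uq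
    have hB : IsOpen B := (continuousOn_extChartAt_symm q).isOpen_inter_preimage
      (isOpen_extChartAt_target q) hUq
    have hB_nonempty : B.Nonempty := ⟨extChartAt (𝓡 d) q q, mem_extChartAt_target q, by
      rw [mem_preimage, extChartAt_to_inv]
      exact ⟨hq, mem_chart_source _ q⟩⟩
    have hint : ∫⁻ y in B, ENNReal.ofReal (volDensity γ q y) = 0 := by
      rw [← chartVolume_apply γ q hUq.measurableSet,
        ← riemVolume_apply γ q hUq.measurableSet inter_subset_right]
      exact measure_mono_null inter_subset_left h0
    rw [lintegral_eq_zero_iff' (((continuousOn_volDensity γ q).mono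
      inter_subset_left).aemeasurable hB.measurableSet).ennreal_ofReal, Filter.EventuallyEq,
      ae_restrict_iff' hB.measurableSet] at hint
    refine (hB.measure_pos volume hB_nonempty).ne' (measure_mono_null (fun y hy => ?_) hint)
    simp [hy, volDensity_pos γ q hy.1]

theorem integral_mul_chartDiv (γ : RMetric d X) (hV : IsSmoothVectorField V) {q : X} {f : X → ℝ}
    (hf : ContMDiff (𝓡 d) 𝓘(ℝ) ∞ f) (hc : HasCompactSupport f)
    (hs : tsupport f ⊆ (chartAt (EuclideanSpace ℝ (Fin d)) q).source) :
    ∫ p, f p * chartDiv γ V q p ∂(riemVolume γ) =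
      -∫ p, mvfderiv (𝓡 d) f p (V p) ∂(riemVolume γ) := by
  rw [integral_riemVolume_eq_chart (q := q) (g := fun p => f p * chartDiv γ V q p) γ
    (hf.continuous.continuousOn.mul (contMDiffOn_chartDiv γ hV q).continuousOn)
    ((Function.support_mul_subset_left _ _).trans ((subset_tsupport f).trans hs)),
    integral_riemVolume_eq_chart (q := q) γ (contMDiff_mvfderiv_apply hf hV).continuous.continuousOn
      ((support_mvfderiv_apply_subset f V).trans hs)]
  simp only [volDensity_mul_chartExtend_mul_chartDiv,
    volDensity_mul_chartExtend_mvfderiv γ hf hc hs]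
  exact integral_sum_fderiv_mul_eq_neg (isOpen_extChartAt_target q)
    (fun i => (contDiffOn_densityComp γ hV q i).of_le (by simp))
    ((contDiff_chartExtend hf hc hs).of_le (by simp)) (hasCompactSupport_chartExtend hc hs)
    (tsupport_chartExtend_subset hc hs) _

end Integral
end Divergence

section DivergenceTheorem
variable {d : ℕ} {X : Type*} [TopologicalSpace X] [ChartedSpace (EuclideanSpace ℝ (Fin d)) X]
  [IsManifold (𝓡 d) ∞ X] [T2Space X] [SecondCountableTopology X]

theorem induction_of_chart {P : (X → ℝ) → Prop} (zero : P 0)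
    (add : ∀ f g : X → ℝ, ContMDiff (𝓡 d) 𝓘(ℝ) ∞ f → HasCompactSupport f →
      ContMDiff (𝓡 d) 𝓘(ℝ) ∞ g → HasCompactSupport g → P f → P g → P (f + g))
    (chart : ∀ (q : X) (f : X → ℝ), ContMDiff (𝓡 d) 𝓘(ℝ) ∞ f → HasCompactSupport f →
      tsupport f ⊆ (chartAt (EuclideanSpace ℝ (Fin d)) q).source → P f)
    {f : X → ℝ} (hf : ContMDiff (𝓡 d) 𝓘(ℝ) ∞ f) (hc : HasCompactSupport f) : P f := by
  classical
  have : LocallyCompactSpace X := ChartedSpace.locallyCompactSpace (EuclideanSpace ℝ (Fin d)) X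
  obtain ⟨ρ, hρ⟩ := SmoothPartitionOfUnity.exists_isSubordinate_chartAt_source (𝓡 d) X
  have hfin : {i | (Function.support (ρ i) ∩ tsupport f).Nonempty}.Finite :=
    ρ.locallyFinite.finite_nonempty_inter_compact hc.isCompact
  have hpartial : ∀ s : Finset X, ContMDiff (𝓡 d) 𝓘(ℝ) ∞ (∑ i ∈ s, ⇑(ρ i) * f) ∧
      HasCompactSupport (∑ i ∈ s, ⇑(ρ i) * f) ∧ P (∑ i ∈ s, ⇑(ρ i) * f) := by
    intro s
    induction s using Finset.induction_on with
    | empty => simpa using ⟨contMDiff_const, HasCompactSupport.zero, zero⟩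
    | insert i s hi ih =>
      have hfi : ContMDiff (𝓡 d) 𝓘(ℝ) ∞ (⇑(ρ i) * f) := (ρ i).contMDiff.mul hf
      have hci : HasCompactSupport (⇑(ρ i) * f) := hc.mul_left
      rw [Finset.sum_insert hi]
      exact ⟨hfi.add ih.1, hci.add ih.2.1, add _ _ hfi hci ih.1 ih.2.1 (chart i _ hfi hci
        ((closure_mono (Function.support_mul_subset_left (ρ i) f)).trans (hρ i))) ih.2.2⟩
  have hsum : f = ∑ i ∈ hfin.toFinset, ⇑(ρ i) * f := by
    ext p
    rw [Finset.sum_apply]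
    by_cases hp : p ∈ tsupport f
    · have hone : ∑ i ∈ hfin.toFinset, ρ i p = 1 := by
        rw [← ρ.sum_eq_one (mem_univ p), finsum_eq_sum_of_support_subset]
        exact fun i hi => hfin.mem_toFinset.2 ⟨p, hi, hp⟩
      simp only [Pi.mul_apply, ← Finset.sum_mul, hone, one_mul]
    · simp [image_eq_zero_of_notMem_tsupport hp]
  rw [hsum]
  exact (hpartial _).2.2

variable [MeasurableSpace X] [BorelSpace X] {V : ∀ p : X, TangentSpace (𝓡 d) p}

-- Both sides integrate to `-∫ Df(V) dγ` against every test function `f` on the overlap.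
theorem eqOn_chartDiv (γ : RMetric d X) (hV : IsSmoothVectorField V) (q r : X) :
    EqOn (chartDiv γ V q) (chartDiv γ V r) ((chartAt (EuclideanSpace ℝ (Fin d)) q).source ∩
      (chartAt (EuclideanSpace ℝ (Fin d)) r).source) := by
  have : LocallyCompactSpace X := ChartedSpace.locallyCompactSpace (EuclideanSpace ℝ (Fin d)) X
  set O := (chartAt (EuclideanSpace ℝ (Fin d)) q).source ∩
    (chartAt (EuclideanSpace ℝ (Fin d)) r).source
  have hO : IsOpen O := (chartAt (EuclideanSpace ℝ (Fin d)) q).open_source.inter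
    (chartAt (EuclideanSpace ℝ (Fin d)) r).open_source
  have hcq : ContinuousOn (chartDiv γ V q) O :=
    (contMDiffOn_chartDiv γ hV q).continuousOn.mono inter_subset_left
  have hcr : ContinuousOn (chartDiv γ V r) O :=
    (contMDiffOn_chartDiv γ hV r).continuousOn.mono inter_subset_right
  have hae := hO.ae_eq_zero_of_integral_contMDiff_smul_eq_zero (𝓡 d) (μ := riemVolume γ)
    ((hcq.sub hcr).locallyIntegrableOn hO.measurableSet) fun g hg hgc hgO => by
      have hint : ∀ {h : X → ℝ}, ContinuousOn h O →
          Integrable (fun p => g p * h p) (riemVolume γ) := fun hh => by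
        simpa only [mul_comm] using
          integrable_mul_of_tsupport_subset hO hh hg.continuous hgc hgO
      simp only [smul_eq_mul, Pi.sub_apply, mul_sub]
      rw [integral_sub (hint hcq) (hint hcr),
        integral_mul_chartDiv γ hV hg hgc (hgO.trans inter_subset_left),
        integral_mul_chartDiv γ hV hg hgc (hgO.trans inter_subset_right), sub_self]
  refine Measure.eqOn_open_of_ae_eq (μ := riemVolume γ) ?_ hO hcq hcr
  rw [Filter.EventuallyEq, ae_restrict_iff' hO.measurableSet]
  filter_upwards [hae] with p hp hpO using sub_eq_zero.1 (hp hpO)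

theorem eqOn_divergence_chartDiv (γ : RMetric d X) (hV : IsSmoothVectorField V) (q : X) :
    EqOn (divergence γ V) (chartDiv γ V q) (chartAt (EuclideanSpace ℝ (Fin d)) q).source :=
  fun p hp => eqOn_chartDiv γ hV p q ⟨mem_chart_source _ p, hp⟩

theorem contMDiff_divergence (γ : RMetric d X) (hV : IsSmoothVectorField V) :
    ContMDiff (𝓡 d) 𝓘(ℝ) ∞ (divergence γ V) := fun q =>
  ((contMDiffOn_chartDiv γ hV q).congr (eqOn_divergence_chartDiv γ hV q)).contMDiffAt
    ((chartAt (EuclideanSpace ℝ (Fin d)) q).open_source.mem_nhds (mem_chart_source _ q))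

theorem integrable_mvfderiv_apply (γ : RMetric d X) (hV : IsSmoothVectorField V) {f : X → ℝ}
    (hf : ContMDiff (𝓡 d) 𝓘(ℝ) ∞ f) (hc : HasCompactSupport f) :
    Integrable (fun p => mvfderiv (𝓡 d) f p (V p)) (riemVolume γ) :=
  (contMDiff_mvfderiv_apply hf hV).continuous.integrable_of_hasCompactSupport
    (HasCompactSupport.of_support_subset_isCompact hc.isCompact
      (support_mvfderiv_apply_subset f V))

theorem integrable_mul_divergence (γ : RMetric d X) (hV : IsSmoothVectorField V) {f : X → ℝ}
    (hf : Continuous f) (hc : HasCompactSupport f) :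
    Integrable (fun p => f p * divergence γ V p) (riemVolume γ) :=
  (hf.mul (contMDiff_divergence γ hV).continuous).integrable_of_hasCompactSupport hc.mul_right

theorem integral_mul_divergence (γ : RMetric d X) (hV : IsSmoothVectorField V) {f : X → ℝ}
    (hf : ContMDiff (𝓡 d) 𝓘(ℝ) ∞ f) (hc : HasCompactSupport f) :
    ∫ p, f p * divergence γ V p ∂(riemVolume γ) =
      -∫ p, mvfderiv (𝓡 d) f p (V p) ∂(riemVolume γ) := by
  refine induction_of_chart (P := fun f => ∫ p, f p * divergence γ V p ∂(riemVolume γ) =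
    -∫ p, mvfderiv (𝓡 d) f p (V p) ∂(riemVolume γ)) ?_ (fun f g hf hfc hg hgc ihf ihg => ?_)
    (fun q f hf hc hs => ?_) hf hc
  · simp
  · have hsum : ∀ p, mvfderiv (𝓡 d) (f + g) p (V p) =
        mvfderiv (𝓡 d) f p (V p) + mvfderiv (𝓡 d) g p (V p) := fun p => by
      rw [mvfderiv_add (hf.mdifferentiableAt (by simp)) (hg.mdifferentiableAt (by simp)),
        add_apply]
    simp only [Pi.add_apply, add_mul, hsum]
    rw [integral_add (integrable_mul_divergence γ hV hf.continuous hfc)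
        (integrable_mul_divergence γ hV hg.continuous hgc), ihf, ihg,
      integral_add (integrable_mvfderiv_apply γ hV hf hfc) (integrable_mvfderiv_apply γ hV hg hgc),
      neg_add]
  · rw [← integral_mul_chartDiv γ hV hf hc hs]
    congr 1 with p
    by_cases hp : p ∈ tsupport f
    · rw [eqOn_divergence_chartDiv γ hV q (hs hp)]
    · simp only [image_eq_zero_of_notMem_tsupport hp, zero_mul]

theorem integrable_mul_divergence_add_mvfderiv (γ : RMetric d X) (hV : IsSmoothVectorField V)
    {f : X → ℝ} (hf : ContMDiff (𝓡 d) 𝓘(ℝ) ∞ f) (hc : HasCompactSupport f) :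
    Integrable (fun p => f p * divergence γ V p + mvfderiv (𝓡 d) f p (V p)) (riemVolume γ) :=
  (integrable_mul_divergence γ hV hf.continuous hc).add (integrable_mvfderiv_apply γ hV hf hc)

theorem integral_mul_divergence_add_mvfderiv (γ : RMetric d X) (hV : IsSmoothVectorField V)
    {f : X → ℝ} (hf : ContMDiff (𝓡 d) 𝓘(ℝ) ∞ f) (hc : HasCompactSupport f) :
    ∫ p, f p * divergence γ V p + mvfderiv (𝓡 d) f p (V p) ∂(riemVolume γ) = 0 := by
  rw [integral_add (integrable_mul_divergence γ hV hf.continuous hc)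
    (integrable_mvfderiv_apply γ hV hf hc), integral_mul_divergence γ hV hf hc, neg_add_cancel]

end DivergenceTheorem

/-! ### Extending bilinear maps to completions -/

section Extension
variable {E F G : Type*} [SeminormedAddCommGroup E] [NormedSpace ℝ E]
  [SeminormedAddCommGroup F] [NormedSpace ℝ F]

theorem norm_apply_le_of_le_sq_add_sq [SeminormedAddCommGroup G] [NormedSpace ℝ G]
    (B : E →ₗ[ℝ] F →ₗ[ℝ] G) {C : ℝ} (hC : 0 ≤ C)
    (h : ∀ x y, ‖B x y‖ ≤ C * (‖x‖ ^ 2 + ‖y‖ ^ 2)) (x : E) (y : F) :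
    ‖B x y‖ ≤ 2 * C * ‖x‖ * ‖y‖ := by
  -- Rescale `x` and `y` to comparable seminorms; `δ` avoids dividing by a vanishing one.
  have hbound : ∀ δ : ℝ, 0 < δ → ‖B x y‖ ≤ 2 * C * (‖x‖ + δ) * (‖y‖ + δ) := by
    intro δ hδ
    have hx : 0 < ‖x‖ + δ := by positivity
    have hy : 0 < ‖y‖ + δ := by positivity
    refine le_of_mul_le_mul_left ?_ (mul_pos hx hy)
    calc (‖x‖ + δ) * (‖y‖ + δ) * ‖B x y‖ = ‖B ((‖y‖ + δ) • x) ((‖x‖ + δ) • y)‖ := by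
          simp only [map_smul, LinearMap.smul_apply, norm_smul, Real.norm_of_nonneg hx.le,
            Real.norm_of_nonneg hy.le]
          ring
      _ ≤ C * (((‖y‖ + δ) * ‖x‖) ^ 2 + ((‖x‖ + δ) * ‖y‖) ^ 2) := by
          simpa only [norm_smul, Real.norm_of_nonneg hx.le, Real.norm_of_nonneg hy.le] using
            h ((‖y‖ + δ) • x) ((‖x‖ + δ) • y)
      _ ≤ C * (((‖y‖ + δ) * (‖x‖ + δ)) ^ 2 + ((‖x‖ + δ) * (‖y‖ + δ)) ^ 2) := by
          gcongr <;> exact le_add_of_nonneg_right hδ.le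
      _ = (‖x‖ + δ) * (‖y‖ + δ) * (2 * C * (‖x‖ + δ) * (‖y‖ + δ)) := by ring
  have hlim : Filter.Tendsto (fun δ : ℝ => 2 * C * (‖x‖ + δ) * (‖y‖ + δ)) (𝓝[>] 0)
      (𝓝 (2 * C * ‖x‖ * ‖y‖)) := by
    have hc : Continuous fun δ : ℝ => 2 * C * (‖x‖ + δ) * (‖y‖ + δ) := by fun_prop
    simpa using (hc.tendsto 0).mono_left (nhdsWithin_le_nhds (s := Ioi 0))
  exact ge_of_tendsto hlim (Filter.eventually_of_mem self_mem_nhdsWithin hbound)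

theorem exists_extension_completion [AddCommGroup G] [UniformSpace G] [IsUniformAddGroup G]
    [T2Space G] [CompleteSpace G] [Module ℝ G] [ContinuousConstSMul ℝ G] (f : E →L[ℝ] G) :
    ∃ f' : UniformSpace.Completion E →L[ℝ] G, ∀ x : E, f' x = f x :=
  ⟨f.extend (UniformSpace.Completion.toComplL (𝕜 := ℝ)), ContinuousLinearMap.extend_eq f
    UniformSpace.Completion.denseRange_coe (UniformSpace.Completion.isUniformInducing_coe E)⟩

theorem exists_extension_bilin [NormedAddCommGroup G] [NormedSpace ℝ G] [CompleteSpace G]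
    (B : E →L[ℝ] F →L[ℝ] G) :
    ∃ B' : UniformSpace.Completion E →L[ℝ] UniformSpace.Completion F →L[ℝ] G,
      ∀ (x : E) (y : F), B' x y = B x y := by
  obtain ⟨B₁, hB₁⟩ := exists_extension_completion B
  obtain ⟨B₂, hB₂⟩ := exists_extension_completion B₁.flip
  exact ⟨B₂.flip, fun x y => by
    rw [ContinuousLinearMap.flip_apply, hB₂, ContinuousLinearMap.flip_apply, hB₁]⟩

end Extension

/-! ### The symplectic form on the energy space -/

section SymplecticForm
variable {d : ℕ} {X : Type*} [TopologicalSpace X] [ChartedSpace (EuclideanSpace ℝ (Fin d)) X]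
  [IsManifold (𝓡 d) ∞ X] {S : SliceData d X} {m : ℝ}

theorem metric_inner_self_nonneg (γ : RMetric d X) (p : X) (v : TangentSpace (𝓡 d) p) :
    0 ≤ γ.inner p v v := by
  by_cases h : v = 0
  · simp [h]
  · exact (γ.pos p _ h).le

theorem mul_sq_add_sq_le_energyDensity {ε : ℝ}
    (hshift : ∀ p : X, ε ≤ S.α p - S.γ.inner p (S.β p) (S.β p) / S.α p)
    (F : InitialData S m) (p : X) :
    ε * (F.mom p ^ 2 + m ^ 2 * F.fld p ^ 2) ≤ InitialData.energyDensity F F p := by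
  have hα := S.α_pos p
  have hεα : ε ≤ S.α p := (hshift p).trans
    (sub_le_self _ (div_nonneg (metric_inner_self_nonneg S.γ p (S.β p)) hα.le))
  calc ε * (F.mom p ^ 2 + m ^ 2 * F.fld p ^ 2)
      = ε * F.mom p ^ 2 + 0 + ε * (m ^ 2 * F.fld p ^ 2) := by ring
    _ ≤ (S.α p - S.γ.inner p (S.β p) (S.β p) / S.α p) * F.mom p ^ 2 +
          S.α p * S.γ.inner p (F.vec p) (F.vec p) + S.α p * (m ^ 2 * F.fld p ^ 2) := by
        gcongr
        · exact hshift p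
        · exact mul_nonneg hα.le (metric_inner_self_nonneg S.γ p _)
    _ = InitialData.energyDensity F F p := by
        rw [InitialData.energyDensity]
        field_simp

theorem sq_add_sq_le_energyDensity (hmass : 0 < m ^ 2) {ε : ℝ} (hε : 0 < ε)
    (hshift : ∀ p : X, ε ≤ S.α p - S.γ.inner p (S.β p) (S.β p) / S.α p)
    (F : InitialData S m) (p : X) :
    F.mom p ^ 2 + F.fld p ^ 2 ≤ (ε * min 1 (m ^ 2))⁻¹ * InitialData.energyDensity F F p := by
  rw [inv_mul_eq_div, le_div_iff₀ (mul_pos hε (lt_min one_pos hmass))]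
  refine le_trans ?_ (mul_sq_add_sq_le_energyDensity hshift F p)
  calc (F.mom p ^ 2 + F.fld p ^ 2) * (ε * min 1 (m ^ 2))
      = ε * (min 1 (m ^ 2) * F.mom p ^ 2 + min 1 (m ^ 2) * F.fld p ^ 2) := by ring
    _ ≤ ε * (1 * F.mom p ^ 2 + m ^ 2 * F.fld p ^ 2) := by
        gcongr
        · exact min_le_left 1 _
        · exact min_le_right 1 _
    _ = ε * (F.mom p ^ 2 + m ^ 2 * F.fld p ^ 2) := by rw [one_mul]

variable [MeasurableSpace X]

theorem sigma_eq_integral (F G : InitialData S m) :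
    sigma F G = ∫ p, F.fld p * G.mom p - F.mom p * G.fld p ∂(riemVolume S.γ) := by
  simp only [sigma, opJ, Pi.neg_apply, mul_neg, sub_eq_add_neg]

theorem sigma_antisymm (F G : InitialData S m) : sigma F G = -sigma G F := by
  rw [sigma_eq_integral, sigma_eq_integral, ← integral_neg]
  congr 1 with p
  ring

theorem sigma_smul_left (c : ℝ) (F G : InitialData S m) : sigma (c • F) G = c • sigma F G := by
  simp only [sigma_eq_integral]
  rw [← integral_smul]
  congr 1 with p
  have hfld : (c • F).fld p = c * F.fld p := rfl
  have hmom : (c • F).mom p = c * F.mom p := rfl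
  rw [hfld, hmom, smul_eq_mul]
  ring

variable [SecondCountableTopology X] [BorelSpace X]

theorem integrable_sigma (F G : InitialData S m) :
    Integrable (fun p => F.fld p * G.mom p - F.mom p * G.fld p) (riemVolume S.γ) :=
  ((F.contMDiff_fld.continuous.mul G.contMDiff_mom.continuous).sub
    (F.contMDiff_mom.continuous.mul G.contMDiff_fld.continuous)).integrable_of_hasCompactSupport
      ((HasCompactSupport.mul_right F.1.2.2).sub (HasCompactSupport.mul_right F.2.2.2))

theorem sigma_add_left (F F' G : InitialData S m) : sigma (F + F') G = sigma F G + sigma F' G := by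
  simp only [sigma_eq_integral]
  rw [← integral_add (integrable_sigma F G) (integrable_sigma F' G)]
  congr 1 with p
  have hfld : (F + F').fld p = F.fld p + F'.fld p := rfl
  have hmom : (F + F').mom p = F.mom p + F'.mom p := rfl
  rw [hfld, hmom]
  ring

/-- The symplectic form `σ` on smooth compactly supported data, bundled as a bilinear map. -/
def sigmaBilin (S : SliceData d X) (m : ℝ) : InitialData S m →ₗ[ℝ] InitialData S m →ₗ[ℝ] ℝ :=
  LinearMap.mk₂ ℝ sigma sigma_add_left sigma_smul_left
    (fun F G G' => by
      rw [sigma_antisymm, sigma_add_left, neg_add, ← sigma_antisymm, ← sigma_antisymm])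
    (fun c F G => by rw [sigma_antisymm, sigma_smul_left, ← smul_neg, ← sigma_antisymm])

variable [T2Space X]

theorem inner_eq_integral (F G : InitialData S m) :
    inner ℝ F G = ∫ p, InitialData.energyDensity F G p ∂(riemVolume S.γ) := rfl

theorem norm_sq_eq_integral (F : InitialData S m) :
    ‖F‖ ^ 2 = ∫ p, InitialData.energyDensity F F p ∂(riemVolume S.γ) := by
  rw [← real_inner_self_eq_norm_sq, inner_eq_integral]

theorem abs_sigma_le (hmass : 0 < m ^ 2) {ε : ℝ} (hε : 0 < ε)
    (hshift : ∀ p : X, ε ≤ S.α p - S.γ.inner p (S.β p) (S.β p) / S.α p) (F G : InitialData S m) :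
    |sigma F G| ≤ (ε * min 1 (m ^ 2))⁻¹ * (‖F‖ ^ 2 + ‖G‖ ^ 2) := by
  have hF := InitialData.integrable_energyDensity F F
  have hG := InitialData.integrable_energyDensity G G
  rw [norm_sq_eq_integral, norm_sq_eq_integral, ← integral_add hF hG, ← integral_const_mul,
    sigma_eq_integral, ← Real.norm_eq_abs]
  refine norm_integral_le_of_norm_le ((hF.add hG).const_mul _)
    (Filter.Eventually.of_forall fun p => ?_)
  have hFp := sq_add_sq_le_energyDensity hmass hε hshift F p
  have hGp := sq_add_sq_le_energyDensity hmass hε hshift G p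
  rw [Real.norm_eq_abs, abs_le]
  constructor <;> nlinarith [sq_nonneg (F.fld p + G.mom p), sq_nonneg (F.fld p - G.mom p),
    sq_nonneg (F.mom p + G.fld p), sq_nonneg (F.mom p - G.fld p)]

theorem exists_sigma_extension (hmass : 0 < m ^ 2) {ε : ℝ} (hε : 0 < ε)
    (hshift : ∀ p : X, ε ≤ S.α p - S.γ.inner p (S.β p) (S.β p) / S.α p) :
    ∃ σ' : EnergySpace S m →L[ℝ] EnergySpace S m →L[ℝ] ℝ,
      ∀ F G : InitialData S m, σ' F G = sigma F G :=
  exists_extension_bilin ((sigmaBilin S m).mkContinuous₂ _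
    (norm_apply_le_of_le_sq_add_sq (sigmaBilin S m)
      (inv_pos.2 (mul_pos hε (lt_min one_pos hmass))).le (abs_sigma_le hmass hε hshift)))

theorem antisymm_of_extends_sigma {σ' : EnergySpace S m →L[ℝ] EnergySpace S m →L[ℝ] ℝ}
    (hσ : ∀ F G : InitialData S m, σ' F G = sigma F G) (Φ Ψ : EnergySpace S m) :
    σ' Φ Ψ = -σ' Ψ Φ := by
  induction Φ, Ψ using UniformSpace.Completion.induction_on₂ with
  | hp => exact isClosed_eq (by fun_prop) (by fun_prop)
  | ih F G => rw [hσ, hσ, sigma_antisymm]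

end SymplecticForm

/-! ### The operator `h` and the symplectic form -/

section Evolution
variable {d : ℕ} {X : Type*} [TopologicalSpace X] [ChartedSpace (EuclideanSpace ℝ (Fin d)) X]
  [IsManifold (𝓡 d) ∞ X] {S : SliceData d X} {m : ℝ}

theorem inner_grad (γ : RMetric d X) (f : X → ℝ) (p : X) (v : TangentSpace (𝓡 d) p) :
    γ.inner p (grad γ f p) v = mvfderiv (𝓡 d) f p v :=
  congrArg (fun l => l v) (inner_sharp γ p _)

theorem mvfderiv_grad_comm (γ : RMetric d X) (f g : X → ℝ) (p : X) :
    mvfderiv (𝓡 d) f p (grad γ g p) = mvfderiv (𝓡 d) g p (grad γ f p) := by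
  rw [← inner_grad, ← inner_grad, γ.symm]

theorem divergence_eq_zero_of_eventually (γ : RMetric d X) {V : ∀ p : X, TangentSpace (𝓡 d) p}
    {q : X} (hV : ∀ᶠ p in 𝓝 q, V p = 0) : divergence γ V q = 0 := by
  have hsymm : Filter.Tendsto (extChartAt (𝓡 d) q).symm (𝓝 (extChartAt (𝓡 d) q q)) (𝓝 q) := by
    simpa only [ContinuousAt, extChartAt_to_inv] using continuousAt_extChartAt_symm (I := 𝓡 d) q
  rw [divergence, Finset.sum_eq_zero, mul_zero]
  intro i _
  have hzero : (fun y => volDensity γ q y * coordComp V q y i) =ᶠ[𝓝 (extChartAt (𝓡 d) q q)]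
      fun _ => (0 : ℝ) := by
    filter_upwards [hsymm.eventually hV] with y hy
    simp only [coordComp, hy, map_zero, PiLp.zero_apply, mul_zero]
  rw [hzero.fderiv_eq, fderiv_fun_const, Pi.zero_apply, zero_apply]

theorem laplacian_eq_zero_of_notMem_tsupport (γ : RMetric d X) {f : X → ℝ} {q : X}
    (hq : q ∉ tsupport f) : laplacian γ f q = 0 := by
  refine divergence_eq_zero_of_eventually γ ?_
  filter_upwards [(isClosed_tsupport f).isOpen_compl.mem_nhds hq] with p hp
  rw [grad, mvfderiv_eq_zero_of_notMem_tsupport hp, sharp, map_zero]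

theorem energyDensity_eq (F G : InitialData S m) (p : X) :
    InitialData.energyDensity F G p = S.α p * (F.mom p * G.mom p)
      + S.α p * mvfderiv (𝓡 d) F.fld p (grad S.γ G.fld p)
      + G.mom p * mvfderiv (𝓡 d) F.fld p (S.β p) + F.mom p * mvfderiv (𝓡 d) G.fld p (S.β p)
      + m ^ 2 * S.α p * (F.fld p * G.fld p) := by
  have hα := (S.α_pos p).ne'
  have hβ : S.γ.inner p (S.β p) (grad S.γ G.fld p) = mvfderiv (𝓡 d) G.fld p (S.β p) := by
    rw [S.γ.symm, inner_grad]
  simp only [InitialData.energyDensity, InitialData.vec, map_add, map_smul, add_apply, smul_apply,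
    smul_eq_mul, inner_grad, hβ]
  field_simp
  ring

variable [T2Space X]

theorem opH_fst_mem_testFn (F : InitialData S m) : (opH S m (F.fld, F.mom)).1 ∈ testFn d X := by
  refine ⟨((contMDiff_mvfderiv_apply F.contMDiff_fld S.contMDiff_β).add
    (S.contMDiff_α.mul F.contMDiff_mom)).neg,
    HasCompactSupport.intro (F.1.2.2.isCompact.union F.2.2.2.isCompact) fun p hp => ?_⟩
  have hfld : p ∉ tsupport F.fld := fun h => hp (Or.inl h)
  have hmom : p ∉ tsupport F.mom := fun h => hp (Or.inr h)
  simp [opH, opJ, opA, mvfderiv_eq_zero_of_notMem_tsupport (d := d) hfld,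
    image_eq_zero_of_notMem_tsupport hmom]

variable [SecondCountableTopology X] [MeasurableSpace X] [BorelSpace X]

theorem contMDiff_laplacian (γ : RMetric d X) {f : X → ℝ} (hf : ContMDiff (𝓡 d) 𝓘(ℝ) ∞ f) :
    ContMDiff (𝓡 d) 𝓘(ℝ) ∞ (laplacian γ f) :=
  contMDiff_divergence γ (contMDiff_grad γ hf)

theorem opH_snd_mem_testFn (F : InitialData S m) : (opH S m (F.fld, F.mom)).2 ∈ testFn d X := by
  refine ⟨(((((contMDiff_mvfderiv_apply F.contMDiff_fld
    (contMDiff_grad S.γ S.contMDiff_α)).neg.add (S.contMDiff_α.mul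
      ((contMDiff_const.mul F.contMDiff_fld).sub (contMDiff_laplacian S.γ F.contMDiff_fld)))).sub
    ((contMDiff_divergence S.γ S.contMDiff_β).mul F.contMDiff_mom)).sub
    (contMDiff_mvfderiv_apply F.contMDiff_mom S.contMDiff_β)).neg).neg,
    HasCompactSupport.intro (F.1.2.2.isCompact.union F.2.2.2.isCompact) fun p hp => ?_⟩
  have hfld : p ∉ tsupport F.fld := fun h => hp (Or.inl h)
  have hmom : p ∉ tsupport F.mom := fun h => hp (Or.inr h)
  simp [opH, opJ, opA, mvfderiv_eq_zero_of_notMem_tsupport (d := d) hfld,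
    mvfderiv_eq_zero_of_notMem_tsupport (d := d) hmom,
    laplacian_eq_zero_of_notMem_tsupport S.γ hfld,
    image_eq_zero_of_notMem_tsupport hfld, image_eq_zero_of_notMem_tsupport hmom]

/-- The data `h F` as an element of `C₀^∞(X) ⊕ C₀^∞(X)`. -/
def hData (F : InitialData S m) : InitialData S m :=
  (⟨_, opH_fst_mem_testFn F⟩, ⟨_, opH_snd_mem_testFn F⟩)

theorem fld_hData (F : InitialData S m) (p : X) :
    (hData F).fld p = -(mvfderiv (𝓡 d) F.fld p (S.β p) + S.α p * F.mom p) := rfl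

theorem mom_hData (F : InitialData S m) (p : X) :
    (hData F).mom p = -(mvfderiv (𝓡 d) F.fld p (grad S.γ S.α p))
      + S.α p * (m ^ 2 * F.fld p - laplacian S.γ F.fld p)
      - divergence S.γ S.β p * F.mom p - mvfderiv (𝓡 d) F.mom p (S.β p) :=
  neg_neg _

-- The two brackets are `div (φ_G α grad φ_F)` and `div (φ_G π_F β)`.
theorem sigma_hData_integrand (G F : InitialData S m) (p : X) :
    G.fld p * (hData F).mom p - G.mom p * (hData F).fld p =
      InitialData.energyDensity G F p -
        (((G.fld * S.α) p * divergence S.γ (grad S.γ F.fld) p +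
            mvfderiv (𝓡 d) (G.fld * S.α) p (grad S.γ F.fld p)) +
          ((G.fld * F.mom) p * divergence S.γ S.β p +
            mvfderiv (𝓡 d) (G.fld * F.mom) p (S.β p))) := by
  have hG := G.contMDiff_fld.mdifferentiableAt (x := p) (n := ∞) (by simp)
  have hα := S.contMDiff_α.mdifferentiableAt (x := p) (n := ∞) (by simp)
  have hF := F.contMDiff_mom.mdifferentiableAt (x := p) (n := ∞) (by simp)
  rw [fld_hData, mom_hData, energyDensity_eq, mvfderiv_mul hG hα, mvfderiv_mul hG hF]
  simp only [Pi.mul_apply, add_apply, smul_apply, smul_eq_mul,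
    mvfderiv_grad_comm S.γ F.fld S.α p, laplacian]
  ring

theorem sigma_hData (G F : InitialData S m) : sigma G (hData F) = inner ℝ G F := by
  have hgrad := contMDiff_grad S.γ F.contMDiff_fld
  have hfα := G.contMDiff_fld.mul S.contMDiff_α
  have hfπ := G.contMDiff_fld.mul F.contMDiff_mom
  have hcα : HasCompactSupport (G.fld * S.α) := HasCompactSupport.mul_right G.1.2.2
  have hcπ : HasCompactSupport (G.fld * F.mom) := HasCompactSupport.mul_right G.1.2.2
  have hintα := integrable_mul_divergence_add_mvfderiv S.γ hgrad hfα hcα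
  have hintπ := integrable_mul_divergence_add_mvfderiv S.γ S.contMDiff_β hfπ hcπ
  simp only [sigma_eq_integral, sigma_hData_integrand]
  rw [integral_sub (InitialData.integrable_energyDensity G F) (hintα.fun_add hintπ),
    integral_add hintα hintπ, integral_mul_divergence_add_mvfderiv S.γ hgrad hfα hcα,
    integral_mul_divergence_add_mvfderiv S.γ S.contMDiff_β hfπ hcπ, add_zero, sub_zero,
    inner_eq_integral]

variable {σ' : EnergySpace S m →L[ℝ] EnergySpace S m →L[ℝ] ℝ}
  {T : EnergySpace S m →L[ℝ] EnergySpace S m}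

theorem apply_hData_of_represents_sigma (hσ : ∀ F G : InitialData S m, σ' F G = sigma F G)
    (hT : ∀ Φ Ψ, σ' Φ Ψ = inner ℝ Φ (T Ψ)) (F : InitialData S m) : T (hData F) = F :=
  UniformSpace.Completion.denseRange_coe.eq_of_inner_right ℝ fun G => by
    rw [← hT, hσ, sigma_hData, UniformSpace.Completion.inner_coe]

theorem denseRange_of_represents_sigma (hσ : ∀ F G : InitialData S m, σ' F G = sigma F G)
    (hT : ∀ Φ Ψ, σ' Φ Ψ = inner ℝ Φ (T Ψ)) : DenseRange T :=
  UniformSpace.Completion.denseRange_coe.mono <| by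
    rintro _ ⟨F, rfl⟩
    exact ⟨_, apply_hData_of_represents_sigma hσ hT F⟩

end Evolution

end StationaryKG
end

theorem theorem4p2_general {d : ℕ}
    {X : Type*} [TopologicalSpace X] [ChartedSpace (EuclideanSpace ℝ (Fin d)) X]
    [IsManifold (𝓡 d) ∞ X] [T2Space X] [SecondCountableTopology X]
    [MeasurableSpace X] [BorelSpace X]
    (S : StationaryKG.SliceData d X) (m : ℝ) (hmass : 0 < m ^ 2) (ε : ℝ) (hε : 0 < ε)
    (hshift : ∀ p : X, ε ≤ S.α p - S.γ.inner p (S.β p) (S.β p) / S.α p) :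
    ∃ σ' : StationaryKG.EnergySpace S m →L[ℝ] StationaryKG.EnergySpace S m →L[ℝ] ℝ,
      (∀ F G : StationaryKG.InitialData S m, σ' F G = StationaryKG.sigma F G) ∧
    ∃ T : StationaryKG.EnergySpace S m →L[ℝ] StationaryKG.EnergySpace S m,
      (∀ Φ Ψ, σ' Φ Ψ = inner ℝ Φ (T Ψ)) ∧
      ContinuousLinearMap.adjoint T = -T ∧
    ∃ A : StationaryKG.EnergySpace S m →ₗ.[ℝ] StationaryKG.EnergySpace S m,
      (∀ Φ Ψ, (Φ, Ψ) ∈ A.graph ↔ T Ψ = Φ) ∧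
      StationaryKG.IsSkewAdjointOp A ∧
      StationaryKG.ExtendsH A ∧
    ∃ U : ℝ → StationaryKG.EnergySpace S m →L[ℝ] StationaryKG.EnergySpace S m,
      StationaryKG.IsEvolution A U ∧
      ∀ t Φ Ψ, σ' (U t Φ) (U t Ψ) = σ' Φ Ψ := by
  obtain ⟨σ', hσ⟩ := StationaryKG.exists_sigma_extension (S := S) hmass hε hshift
  obtain ⟨T, hskew, hT⟩ := StationaryKG.exists_skewAdjoint_of_antisymm σ'
    (StationaryKG.antisymm_of_extends_sigma hσ)
  have hdense : DenseRange T := StationaryKG.denseRange_of_represents_sigma hσ hT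
  have hinj : Function.Injective T := StationaryKG.injective_of_mem_skewAdjoint hskew hdense
  obtain ⟨U, hU, hcomm⟩ := StationaryKG.exists_isEvolution_inverseOp hskew hdense
  refine ⟨σ', hσ, T, hT, skewAdjoint.mem_iff.1 hskew, StationaryKG.inverseOp T,
    fun _ _ => StationaryKG.mem_graph_inverseOp hinj,
    StationaryKG.isSkewAdjointOp_inverseOp hskew hdense, fun F => ⟨StationaryKG.hData F, rfl,
      (StationaryKG.mem_graph_inverseOp hinj).2
        (StationaryKG.apply_hData_of_represents_sigma hσ hT F)⟩, U, hU, fun t Φ Ψ => ?_⟩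
  rw [hT, hT, ← hcomm, hU.inner_map_map]

theorem theorem4p2 {d : ℕ}
    {M : Type*} [TopologicalSpace M] [ChartedSpace (EuclideanSpace ℝ (Fin (d + 1))) M]
    [IsManifold (𝓡 (d + 1)) ∞ M]
    {X : Type*} [TopologicalSpace X] [ChartedSpace (EuclideanSpace ℝ (Fin d)) X]
    [IsManifold (𝓡 d) ∞ X] [T2Space X] [SecondCountableTopology X]
    [MeasurableSpace X] [BorelSpace X]
    (N : StationaryKG.StationarySpacetime d M) (C : StationaryKG.SpatialSlice N X)
    (m : ℝ) (hmass : 0 < m ^ 2)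
    (ε : ℝ) (hε : 0 < ε)
    (hshift : ∀ p : X, ε ≤ C.data.α p - C.data.γ.inner p (C.data.β p) (C.data.β p) / C.data.α p) :
    -- `σ` extends to a continuous bilinear form `σ'` on the energy space
    ∃ σ' : StationaryKG.EnergySpace C.data m →L[ℝ] StationaryKG.EnergySpace C.data m →L[ℝ] ℝ,
      (∀ F G : StationaryKG.InitialData C.data m, σ' F G = StationaryKG.sigma F G) ∧
    -- which is represented by a bounded skew-adjoint operator `T`
    ∃ T : StationaryKG.EnergySpace C.data m →L[ℝ] StationaryKG.EnergySpace C.data m,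
      (∀ Φ Ψ, σ' Φ Ψ = inner ℝ Φ (T Ψ)) ∧
      ContinuousLinearMap.adjoint T = -T ∧
    -- `A = T⁻¹` is a skew-adjoint extension of `h`
    ∃ A : StationaryKG.EnergySpace C.data m →ₗ.[ℝ] StationaryKG.EnergySpace C.data m,
      (∀ Φ Ψ, (Φ, Ψ) ∈ A.graph ↔ T Ψ = Φ) ∧
      StationaryKG.IsSkewAdjointOp A ∧
      StationaryKG.ExtendsH A ∧
    -- and the evolution `e^{-At}` conserves `σ`
    ∃ U : ℝ → StationaryKG.EnergySpace C.data m →L[ℝ] StationaryKG.EnergySpace C.data m,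
      StationaryKG.IsEvolution A U ∧
      ∀ t Φ Ψ, σ' (U t Φ) (U t Ψ) = σ' Φ Ψ :=
  theorem4p2_general C.data m hmass ε hε hshift
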